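/- Setting. Let $\mathsf k$ and $\mathsf h$ be complex Hilbert spaces and let $\mathcal A\subseteq B(\mathsf h)$ be a von Neumann algebra. For an interval $J\subseteq\mathbb R_+$ let $\mathcal F_J$ be the Boson Fock space over $L^2(J;\mathsf k)$, with exponential vectors $\varepsilon(f)$, and put $\mathcal F=\mathcal F_{[0,\infty)}$, $\mathcal F_{t)}=\mathcal F_{[0,t)}$, $\mathcal F_{[t}=\mathcal F_{[t,\infty)}$, with identity operators $I$, $I_{t)}$, $I_{[t}$. Identify $\mathcal F\cong\mathcal F_{t)}\otimes\mathcal F_{[t}$ through $\varepsilon(f)\leftrightarrow\varepsilon(f|_{[0,t)})\otimes\varepsilon(f|_{[t,\infty)})$. A finite quantum stop time $S$ is a spectral measure on the Borel $\sigma$-algebra of $[0,\infty]$ with values in $B(\mathcal F)$ (each $S(A)$ is an orthogonal projection, each $A\mapsto\langle x,S(A)y\rangle$ is a complex measure, and $S([0,\infty])=I$) such that $S([0,t])\in B(\mathcal F_{t)})\otimes I_{[t}$ for all $t\in(0,\infty)$, $S(\{0\})=0$ and $S(\{\infty\})=0$. We also write $S(A)$ for $I_{\mathsf h}\otimes S(A)$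 acting on $\mathsf h\otimes\mathcal F$. Let $p$ be an orthogonal projection on $\mathsf k$ and let $P_{[t}\in B(\mathcal F_{[t})$ be the second quantisation of $p$ acting pointwise, so that $P_{[t}\varepsilon(f)=\varepsilon(pf)$. A $p$-adapted process is a family $V=(V_t)_{t\ge0}$ in the von Neumann algebra tensor product $\mathcal A\,\overline\otimes\,B(\mathcal F)$ with $V_t=V_{t)}\otimes P_{[t}$ and $V_{t)}\in\mathcal A\,\overline\otimes\,B(\mathcal F_{t)})$ for all $t\ge0$; put $\widehat V_t=V_{t)}\otimes I_{[t}$. Let $\Gamma_t:\mathcal F\to\mathcal F_{[t}$ be the unitary operator with $\Gamma_t\varepsilon(f)=\varepsilon(f(\cdot-t))$, and let $\sigma_t(X)=I_{t)}\otimes\Gamma_tX\Gamma_t^*$ be the CCR flow, extended by ampliation to operators on $\mathsf h\otimes\mathcal F$. The process $V$ is a cocycle if $V_{s+t}=\widehat V_s\,\sigma_s(V_t)$ for all $s,t\ge0$, it is isometric if $V_{t)}^*V_{t)}=I_{\mathsf h}\otimes I_{t)}$ for all $t\ge0$, and it is strongly continuous if $t\mapsto V_tz$ is continuous for every $z\in\mathsf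 h\otimes\mathcal F$. Theorem. Let $S$ be a finite quantum stop time and let $V$ be a strongly continuous isometric $p$-adapted cocycle. For every $t\in(0,\infty)$ there is a bounded operator $V_{S,t}$ on $\mathsf h\otimes\mathcal F$ such that, for every $z\in\mathsf h\otimes\mathcal F$, $$V_{S,t}z=\lim_{\pi}\ \sum_{j=1}^{n+1}V_{\pi_j}S\bigl((\pi_{j-1},\pi_j]\bigr)z ,$$ where the limit is taken over the finite partitions $\pi=\{0=\pi_0<\dots<\pi_{n+1}=t\}$ of $[0,t]$, directed by refinement. Moreover $$V_{S,t}=V_{S,t}\,S([0,t])\qquad\text{and}\qquad\|V_{S,t}z\|\le\|S([0,t])z\|\quad\text{for all }z\in\mathsf h\otimes\mathcal F .$$ Furthermore, there is a bounded operator $V_S$ on $\mathsf h\otimes\mathcal F$ such that $V_Sz=\lim_{t\to\infty}V_{S,t}z$ for every $z\in\mathsf h\otimes\mathcal F$. -/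

import Mathlib

open MeasureTheory Filter Topology
open scoped ENNReal NNReal TensorProduct InnerProductSpace

namespace QStop

universe u v

section Hilbert

variable {E : Type*} [NormedAddCommGroup E] [InnerProductSpace ℂ E]
variable {F : Type*} [NormedAddCommGroup F] [InnerProductSpace ℂ F]
variable {E' : Type*} [NormedAddCommGroup E'] [InnerProductSpace ℂ E']
variable {F' : Type*} [NormedAddCommGroup F'] [InnerProductSpace ℂ F']

/-- A family of vectors is total if its linear span is dense. -/
def Total {ι : Type*} (a : ι → E) : Prop :=
  (Submodule.span ℂ (Set.range a)).topologicalClosure = ⊤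

/-- The Hilbert space tensor product: the completion of the algebraic tensor product. -/
abbrev HTensor (E F : Type*) [NormedAddCommGroup E] [InnerProductSpace ℂ E]
    [NormedAddCommGroup F] [InnerProductSpace ℂ F] : Type _ :=
  UniformSpace.Completion (E ⊗[ℂ] F)

/-- The elementary tensor `x ⊗ y` in the Hilbert space tensor product. -/
noncomputable def tmul (x : E) (y : F) : HTensor E F := ((x ⊗ₜ[ℂ] y : E ⊗[ℂ] F) : HTensor E F)

/-- The tensor product `A ⊗ B` of two bounded operators. -/
noncomputable def tmap (A : E →L[ℂ] E') (B : F →L[ℂ] F') : HTensor E F →L[ℂ] HTensor E' F' :=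
  (TensorProduct.mapL A B).completion

theorem tmap_tmul (A : E →L[ℂ] E') (B : F →L[ℂ] F') (x : E) (y : F) :
    tmap A B (tmul x y) = tmul (A x) (B y) := by
  simp [tmap, tmul]

theorem inner_tmul (x x' : E) (y y' : F) :
    ⟪tmul x y, tmul x' y'⟫_ℂ = ⟪x, x'⟫_ℂ * ⟪y, y'⟫_ℂ := by
  simp [tmul]

theorem continuous_tmul : Continuous fun z : E × F => tmul z.1 z.2 :=
  (UniformSpace.Completion.continuous_coe _).comp TensorProduct.continuous_tmul

theorem tmul_add (x : E) (y y' : F) : tmul x (y + y') = tmul x y + tmul x y' := by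
  simp only [tmul, TensorProduct.tmul_add, UniformSpace.Completion.coe_add]

theorem add_tmul (x x' : E) (y : F) : tmul (x + x') y = tmul x y + tmul x' y := by
  simp only [tmul, TensorProduct.add_tmul, UniformSpace.Completion.coe_add]

theorem tmul_smul (c : ℂ) (x : E) (y : F) : tmul x (c • y) = c • tmul x y := by
  simp only [tmul, TensorProduct.tmul_smul, UniformSpace.Completion.coe_smul]

theorem smul_tmul (c : ℂ) (x : E) (y : F) : tmul (c • x) y = c • tmul x y := by
  rw [tmul, tmul, ← TensorProduct.smul_tmul', UniformSpace.Completion.coe_smul]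

theorem tmul_mem_closure {S : Set E} {T : Set F} {W : Submodule ℂ (HTensor E F)}
    (hW : IsClosed (W : Set (HTensor E F))) (h : ∀ x ∈ S, ∀ y ∈ T, tmul x y ∈ W)
    {x : E} {y : F} (hx : x ∈ (Submodule.span ℂ S).topologicalClosure)
    (hy : y ∈ (Submodule.span ℂ T).topologicalClosure) : tmul x y ∈ W := by
  have h1 : ∀ x ∈ S, ∀ y ∈ (Submodule.span ℂ T).topologicalClosure, tmul x y ∈ W := by
    intro x hx y hy
    have hc : Continuous fun y : F => tmul x y :=
      continuous_tmul.comp (Continuous.prodMk_right x)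
    have : (Submodule.span ℂ T : Set F) ⊆ (fun y => tmul x y) ⁻¹' (W : Set (HTensor E F)) := by
      intro y hy
      change tmul x y ∈ W
      induction hy using Submodule.span_induction with
      | mem y hy => exact h x hx y hy
      | zero => rw [← zero_smul ℂ (0 : F), tmul_smul, zero_smul]; exact W.zero_mem
      | add a b _ _ ha hb => exact tmul_add x a b ▸ W.add_mem ha hb
      | smul c a _ ha => exact tmul_smul c x a ▸ W.smul_mem c ha
    exact closure_minimal this (hW.preimage hc) hy
  have hc : Continuous fun x : E => tmul x y :=
    continuous_tmul.comp (Continuous.prodMk_left y)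
  have : (Submodule.span ℂ S : Set E) ⊆ (fun x => tmul x y) ⁻¹' (W : Set (HTensor E F)) := by
    intro x hx
    change tmul x y ∈ W
    induction hx using Submodule.span_induction with
    | mem x hx => exact h1 x hx y hy
    | zero => rw [← zero_smul ℂ (0 : E), smul_tmul, zero_smul]; exact W.zero_mem
    | add a b _ _ ha hb => exact add_tmul a b y ▸ W.add_mem ha hb
    | smul c a _ ha => exact smul_tmul c a y ▸ W.smul_mem c ha
  exact closure_minimal this (hW.preimage hc) hx

theorem total_of_tmul {W : Submodule ℂ (HTensor E F)}
    (hW : IsClosed (W : Set (HTensor E F))) (h : ∀ x y, tmul x y ∈ W) : W = ⊤ := by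
  rw [eq_top_iff]
  rintro z -
  induction z using UniformSpace.Completion.induction_on with
  | hp => exact hW
  | ih z =>
    induction z using TensorProduct.induction_on with
    | zero => exact W.zero_mem
    | tmul x y => exact h x y
    | add a b ha hb =>
      rw [UniformSpace.Completion.coe_add]
      exact W.add_mem ha hb

theorem Total.tmul {ι κ : Type*} {a : ι → E} {b : κ → F} (ha : Total a) (hb : Total b) :
    Total fun z : ι × κ => tmul (a z.1) (b z.2) := by
  refine total_of_tmul (Submodule.isClosed_topologicalClosure _) fun x y => ?_
  refine tmul_mem_closure (S := Set.range a) (T := Set.range b)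
    (Submodule.isClosed_topologicalClosure _) ?_ ?_ ?_
  · rintro _ ⟨i, rfl⟩ _ ⟨j, rfl⟩
    exact Submodule.le_topologicalClosure _ (Submodule.subset_span ⟨(i, j), rfl⟩)
  · rw [show (Submodule.span ℂ (Set.range a)).topologicalClosure = ⊤ from ha]; trivial
  · rw [show (Submodule.span ℂ (Set.range b)).topologicalClosure = ⊤ from hb]; trivial

theorem total_id : Total (fun x : E => x) := by
  rw [Total, Set.range_id', Submodule.span_univ, eq_top_iff]
  exact Submodule.le_topologicalClosure _

theorem Total.mono {ι κ : Type*} {a : ι → E} {b : κ → E} (ha : Total a)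
    (h : Set.range a ⊆ Set.range b) : Total b := by
  rw [Total, eq_top_iff, ← (show (Submodule.span ℂ (Set.range a)).topologicalClosure = ⊤ from ha)]
  exact Submodule.topologicalClosure_mono (Submodule.span_mono h)

theorem norm_linearCombination_eq {ι : Type*} {a : ι → E} {b : ι → F}
    (hab : ∀ i j, ⟪a i, a j⟫_ℂ = ⟪b i, b j⟫_ℂ) (x : ι →₀ ℂ) :
    ‖Finsupp.linearCombination ℂ b x‖ = ‖Finsupp.linearCombination ℂ a x‖ := by
  rw [@norm_eq_sqrt_re_inner ℂ, @norm_eq_sqrt_re_inner ℂ]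
  simp only [Finsupp.linearCombination_apply, Finsupp.sum, sum_inner, inner_sum, inner_smul_left,
    inner_smul_right, hab]

theorem Total.denseRange {ι : Type*} {a : ι → E} (ha : Total a) :
    DenseRange (Finsupp.linearCombination ℂ a) := by
  rw [DenseRange, ← LinearMap.coe_range, Finsupp.range_linearCombination,
    Submodule.dense_iff_topologicalClosure_eq_top]
  exact ha

/-- Two total families with the same Gram matrix define a unitary operator taking one family
to the other. -/
noncomputable def gramUnitary {ι : Type*} [CompleteSpace E] [CompleteSpace F]
    (a : ι → E) (b : ι → F) (ha : Total a) (hb : Total b)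
    (hab : ∀ i j, ⟪a i, a j⟫_ℂ = ⟪b i, b j⟫_ℂ) : E ≃ₗᵢ[ℂ] F :=
  (LinearEquiv.refl ℂ (ι →₀ ℂ)).extendOfIsometry (Finsupp.linearCombination ℂ a)
    (Finsupp.linearCombination ℂ b) ha.denseRange hb.denseRange (norm_linearCombination_eq hab)

theorem gramUnitary_apply {ι : Type*} [CompleteSpace E] [CompleteSpace F]
    (a : ι → E) (b : ι → F) (ha : Total a) (hb : Total b)
    (hab : ∀ i j, ⟪a i, a j⟫_ℂ = ⟪b i, b j⟫_ℂ) (i : ι) :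
    gramUnitary a b ha hb hab (a i) = b i := by
  have := LinearEquiv.extendOfIsometry_eq (LinearEquiv.refl ℂ (ι →₀ ℂ))
    (Finsupp.linearCombination ℂ a) (Finsupp.linearCombination ℂ b) ha.denseRange hb.denseRange
    (norm_linearCombination_eq hab) (Finsupp.single i 1)
  simpa [gramUnitary] using this

/-- The bounded operator `U* A U` obtained by transporting `A` along the unitary `U`. -/
noncomputable def pull (U : E ≃ₗᵢ[ℂ] F) (A : F →L[ℂ] F) : E →L[ℂ] E :=
  (U.symm.toContinuousLinearEquiv : F →L[ℂ] E) ∘L A ∘L (U.toContinuousLinearEquiv : E →L[ℂ] F)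

theorem pull_apply (U : E ≃ₗᵢ[ℂ] F) (A : F →L[ℂ] F) (x : E) :
    pull U A x = U.symm (A (U x)) := rfl

end Hilbert

section Fock

/-- A bundled complex Hilbert space (used only to define tensor powers by recursion). -/
structure HilbertSpace : Type (u + 1) where
  carrier : Type u
  [normed : NormedAddCommGroup carrier]
  [innerProd : InnerProductSpace ℂ carrier]
  [complete : CompleteSpace carrier]

variable (h : Type u) [NormedAddCommGroup h] [InnerProductSpace ℂ h]

/-- The recursion behind the tensor powers: `h^{⊗0} = ℂ` and `h^{⊗(n+1)} = h^{⊗n} ⊗ h`. -/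
noncomputable def tensorPowerAux : ℕ → HilbertSpace.{u}
  | 0 => ⟨EuclideanSpace ℂ PUnit.{u + 1}⟩
  | n + 1 =>
    letI := (tensorPowerAux n).normed
    letI := (tensorPowerAux n).innerProd
    ⟨HTensor (tensorPowerAux n).carrier h⟩

/-- The `n`-fold Hilbert space tensor power of `h`. -/
def TPow (n : ℕ) : Type u := (tensorPowerAux h n).carrier

noncomputable instance (n : ℕ) : NormedAddCommGroup (TPow h n) := (tensorPowerAux h n).normed
noncomputable instance (n : ℕ) : InnerProductSpace ℂ (TPow h n) := (tensorPowerAux h n).innerProd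
instance (n : ℕ) : CompleteSpace (TPow h n) := (tensorPowerAux h n).complete

variable {h}

/-- The vector `f ⊗ ⋯ ⊗ f` in the `n`-fold tensor power. -/
noncomputable def tpow (f : h) : (n : ℕ) → TPow h n
  | 0 => (EuclideanSpace.single PUnit.unit (1 : ℂ) : EuclideanSpace ℂ PUnit.{u + 1})
  | n + 1 => (tmul (tpow f n) f : HTensor (TPow h n) h)

theorem inner_tpow (f g : h) (n : ℕ) : ⟪tpow f n, tpow g n⟫_ℂ = ⟪f, g⟫_ℂ ^ n := by
  induction n with
  | zero =>
    refine (EuclideanSpace.inner_single_left (𝕜 := ℂ) PUnit.unit (1 : ℂ) _).trans ?_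
    simp [tpow]
  | succ n ih =>
    refine (inner_tmul (tpow f n) (tpow g n) f g).trans ?_
    rw [ih, pow_succ]

variable (h) in
/-- The `n`-fold symmetric tensor power, the closed linear span of the vectors `f ⊗ ⋯ ⊗ f`. -/
noncomputable def SymPow (n : ℕ) : Submodule ℂ (TPow h n) :=
  (Submodule.span ℂ (Set.range fun f : h => tpow f n)).topologicalClosure

instance (n : ℕ) : CompleteSpace (SymPow h n) :=
  (Submodule.isClosed_topologicalClosure _).completeSpace_coe

/-- `f ⊗ ⋯ ⊗ f` as an element of the symmetric tensor power. -/
noncomputable def spow (f : h) (n : ℕ) : SymPow h n :=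
  ⟨tpow f n, Submodule.le_topologicalClosure _ (Submodule.subset_span ⟨f, rfl⟩)⟩

theorem inner_spow (f g : h) (n : ℕ) : ⟪spow f n, spow g n⟫_ℂ = ⟪f, g⟫_ℂ ^ n :=
  inner_tpow f g n

variable (h) in
/-- The Boson Fock space over `h`: the Hilbert space direct sum of the symmetric tensor powers
of `h`. -/
def Fock : Type u := lp (fun n => SymPow h n) 2

noncomputable instance : NormedAddCommGroup (Fock h) :=
  inferInstanceAs (NormedAddCommGroup (lp (fun n => SymPow h n) 2))
noncomputable instance : InnerProductSpace ℂ (Fock h) :=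
  inferInstanceAs (InnerProductSpace ℂ (lp (fun n => SymPow h n) 2))
instance : CompleteSpace (Fock h) :=
  inferInstanceAs (CompleteSpace (lp (fun n => SymPow h n) 2))

/-- The `n`-particle component of a vector in Fock space. -/
def comp (x : Fock h) (n : ℕ) : SymPow h n := (show lp (fun n => SymPow h n) 2 from x) n

theorem memlp_expVec (f : h) :
    Memℓp (fun n => ((Real.sqrt n.factorial : ℂ)⁻¹) • spow f n) 2 := by
  refine memℓp_gen ?_
  have hs : Summable fun n : ℕ => (‖f‖ ^ 2) ^ n / n.factorial :=
    Real.summable_pow_div_factorial _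
  refine hs.congr fun n => ?_
  have h1 : ‖spow f n‖ ^ 2 = (‖f‖ ^ 2) ^ n := by
    have := inner_spow f f n
    rw [inner_self_eq_norm_sq_to_K, inner_self_eq_norm_sq_to_K] at this
    exact_mod_cast this
  have h2 : (ENNReal.toReal 2) = ((2 : ℕ) : ℝ) := by simp
  rw [h2, Real.rpow_natCast, norm_smul, mul_pow, h1, norm_inv, Complex.norm_real,
    Real.norm_of_nonneg (Real.sqrt_nonneg _), inv_pow, Real.sq_sqrt (Nat.cast_nonneg _)]
  rw [div_eq_mul_inv, mul_comm]

/-- The exponential vector `ε(f) = (f^{⊗n} / √n!)_n`. -/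
noncomputable def expVec (f : h) : Fock h :=
  (⟨fun n => ((Real.sqrt n.factorial : ℂ)⁻¹) • spow f n, memlp_expVec f⟩ :
    lp (fun n => SymPow h n) 2)

theorem hasSum_inner_expVec (x : Fock h) (f : h) :
    HasSum (fun n : ℕ => (Real.sqrt n.factorial : ℂ)⁻¹ *
      ⟪comp x n, spow f n⟫_ℂ) ⟪x, expVec f⟫_ℂ := by
  have e : (fun n : ℕ => (Real.sqrt n.factorial : ℂ)⁻¹ *
      ⟪comp x n, spow f n⟫_ℂ) =
      fun n => ⟪comp x n,
        comp (expVec f) n⟫_ℂ :=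
    funext fun n => (inner_smul_right _ _ _).symm
  rw [e]
  exact lp.hasSum_inner (𝕜 := ℂ) (G := fun n => SymPow h n) x (expVec f)

theorem inner_expVec (f g : h) : ⟪expVec f, expVec g⟫_ℂ = Complex.exp ⟪f, g⟫_ℂ := by
  refine (hasSum_inner_expVec (expVec f) g).unique ?_
  have e : (fun n : ℕ => (Real.sqrt n.factorial : ℂ)⁻¹ *
      ⟪comp (expVec f) n, spow g n⟫_ℂ) =
      fun n : ℕ => ⟪f, g⟫_ℂ ^ n / n.factorial := by
    funext n
    have h1 : ⟪comp (expVec f) n, spow g n⟫_ℂ =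
        (Real.sqrt n.factorial : ℂ)⁻¹ * ⟪f, g⟫_ℂ ^ n := by
      refine (inner_smul_left (spow f n) (spow g n) _).trans ?_
      rw [inner_spow]
      simp
    have h2 : (Real.sqrt n.factorial : ℂ) * (Real.sqrt n.factorial : ℂ) = n.factorial := by
      rw [← Complex.ofReal_mul, Real.mul_self_sqrt (Nat.cast_nonneg _)]
      simp
    rw [h1, ← mul_assoc, ← mul_inv, h2, div_eq_mul_inv, mul_comm]
  rw [e, Complex.exp_eq_exp_ℂ]
  exact NormedSpace.expSeries_div_hasSum_exp _

theorem tpow_smul (c : ℂ) (f : h) (n : ℕ) : tpow (c • f) n = c ^ n • tpow f n := by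
  induction n with
  | zero => rw [pow_zero, one_smul]; rfl
  | succ n ih =>
    refine (congrArg (fun v => (tmul v (c • f) : HTensor (TPow h n) h)) ih).trans ?_
    rw [smul_tmul, tmul_smul, smul_smul, ← pow_succ]
    rfl

theorem total_expVec : Total (expVec : h → Fock h) := by
  rw [Total, Submodule.topologicalClosure_eq_top_iff, Submodule.eq_bot_iff]
  intro x hx
  have hx0 : ∀ f : h, ⟪x, expVec f⟫_ℂ = 0 := fun f =>
    (Submodule.mem_orthogonal' _ x).1 hx _ (Submodule.subset_span ⟨f, rfl⟩)
  have key : ∀ (f : h) (n : ℕ), ⟪comp x n, spow f n⟫_ℂ = 0 := by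
    intro f n
    let c : ℕ → ℂ := fun n => (Real.sqrt n.factorial : ℂ)⁻¹ * ⟪comp x n, spow f n⟫_ℂ
    have hp : HasFPowerSeriesAt (0 : ℂ → ℂ) (FormalMultilinearSeries.ofScalars ℂ c) 0 := by
      rw [hasFPowerSeriesAt_iff]
      refine Filter.Eventually.of_forall fun z => ?_
      have h1 := hasSum_inner_expVec x (z • f)
      rw [hx0] at h1
      have e : (fun n : ℕ => z ^ n • (FormalMultilinearSeries.ofScalars ℂ c).coeff n) =
          fun n : ℕ => (Real.sqrt n.factorial : ℂ)⁻¹ * ⟪comp x n, spow (z • f) n⟫_ℂ := by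
        funext n
        have h2 : spow (z • f) n = z ^ n • spow f n := Subtype.ext (tpow_smul z f n)
        rw [h2, inner_smul_right, FormalMultilinearSeries.coeff_ofScalars]
        simp only [c, smul_eq_mul]
        ring
      exact (congrArg (fun u => HasSum u (0 : ℂ)) e).mpr h1
    have h0 := congrArg (fun p => FormalMultilinearSeries.coeff p n) hp.eq_zero
    rw [FormalMultilinearSeries.coeff_ofScalars] at h0
    have h3 : c n = 0 := h0
    refine (mul_eq_zero.1 h3).resolve_left (inv_ne_zero ?_)
    exact_mod_cast (Real.sqrt_pos.2 (Nat.cast_pos.2 n.factorial_pos)).ne'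
  have hz : ∀ n, comp x n = 0 := by
    intro n
    have hc : ∀ w ∈ SymPow h n, ⟪(comp x n : TPow h n), w⟫_ℂ = 0 := by
      have hcl : IsClosed {w : TPow h n | ⟪(comp x n : TPow h n), w⟫_ℂ = 0} :=
        isClosed_eq (by fun_prop) continuous_const
      refine fun w hw => closure_minimal ?_ hcl hw
      intro w hw
      change ⟪(comp x n : TPow h n), w⟫_ℂ = 0
      induction hw using Submodule.span_induction with
      | mem w hw =>
        obtain ⟨f, rfl⟩ := hw
        exact key f n
      | zero => simp
      | add a b _ _ ha hb => rw [inner_add_right, ha, hb, add_zero]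
      | smul c a _ ha => rw [inner_smul_right, ha, mul_zero]
    exact Subtype.ext (inner_self_eq_zero.1 (hc _ (comp x n).2))
  exact lp.ext (funext hz)

end Fock
section HalfLine

variable (k : Type u) [NormedAddCommGroup k] [InnerProductSpace ℂ k] [CompleteSpace k]

/-- The Hilbert space `L²(A; k)` for a subset `A` of the real line with Lebesgue measure. -/
abbrev L2 (A : Set ℝ) : Type u := Lp k 2 (volume.restrict A)

/-- Boson Fock space over `L²(A; k)`. -/
abbrev FockOn (A : Set ℝ) : Type u := Fock (L2 k A)

/-- The half-line `ℝ₊ = [0, ∞)`. -/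
abbrev half : Set ℝ := Set.Ici 0

/-- The interval `[0, t)`. -/
abbrev past (t : ℝ≥0) : Set ℝ := Set.Ico 0 t

/-- The interval `[t, ∞)`. -/
abbrev future (t : ℝ≥0) : Set ℝ := Set.Ici t

theorem past_subset (t : ℝ≥0) : past t ⊆ half := Set.Ico_subset_Ici_self

theorem future_subset (t : ℝ≥0) : future t ⊆ half := Set.Ici_subset_Ici.2 t.2

variable {k}

/-- The restriction `f|_A` of `f ∈ L²(B; k)` to a subset `A` of `B`. -/
noncomputable def res {A B : Set ℝ} (hAB : A ⊆ B) (f : L2 k B) : L2 k A :=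
  ((Lp.memLp f).mono_measure (Measure.restrict_mono hAB le_rfl)).toLp f

theorem coeFn_res {A B : Set ℝ} (hAB : A ⊆ B) (f : L2 k B) :
    res hAB f =ᵐ[volume.restrict A] f := MemLp.coeFn_toLp _

theorem inner_res {A B : Set ℝ} (hAB : A ⊆ B) (f g : L2 k B) :
    ⟪res hAB f, res hAB g⟫_ℂ = ∫ x in A, ⟪f x, g x⟫_ℂ := by
  rw [L2.inner_def]
  refine integral_congr_ae ?_
  filter_upwards [coeFn_res hAB f, coeFn_res hAB g] with x hf hg
  rw [hf, hg]

theorem past_union_future (t : ℝ≥0) : past t ∪ future t = half :=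
  Set.Ico_union_Ici_eq_Ici t.2

theorem inner_split (t : ℝ≥0) (f g : L2 k half) :
    ⟪f, g⟫_ℂ = ⟪res (past_subset t) f, res (past_subset t) g⟫_ℂ +
      ⟪res (future_subset t) f, res (future_subset t) g⟫_ℂ := by
  rw [inner_res, inner_res, L2.inner_def]
  have hd : Disjoint (past t) (future t) := by
    rw [Set.disjoint_left]
    exact fun x hx hy => not_lt.2 hy hx.2
  have hi := L2.integrable_inner (𝕜 := ℂ) f g
  rw [← setIntegral_union hd measurableSet_Ici
    (IntegrableOn.mono_set (t := half) hi (past_subset t))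
    (IntegrableOn.mono_set (t := half) hi (future_subset t)), past_union_future]

theorem exists_glue (t : ℝ≥0) (a : L2 k (past t)) (b : L2 k (future t)) :
    ∃ f : L2 k half, res (past_subset t) f = a ∧ res (future_subset t) f = b := by
  have hp : MeasurableSet (past t) := measurableSet_Ico
  have hfm : MeasurableSet (future t) := measurableSet_Ici
  have ha : MemLp ((past t).indicator a) 2 (volume.restrict half) :=
    ((memLp_indicator_iff_restrict hp).2 (Lp.memLp a)).restrict _
  have hb : MemLp ((future t).indicator b) 2 (volume.restrict half) :=
    ((memLp_indicator_iff_restrict hfm).2 (Lp.memLp b)).restrict _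
  refine ⟨(ha.add hb).toLp _, ?_, ?_⟩
  · refine Lp.ext ((coeFn_res _ _).trans ?_)
    have h1 := ae_restrict_of_ae_restrict_of_subset (past_subset t) (ha.add hb).coeFn_toLp
    filter_upwards [h1, ae_restrict_mem hp] with x hx hxm
    rw [hx]
    have : x ∉ future t := fun hy => not_lt.2 hy hxm.2
    simp [Set.indicator_of_mem hxm, Set.indicator_of_notMem this]
  · refine Lp.ext ((coeFn_res _ _).trans ?_)
    have h1 := ae_restrict_of_ae_restrict_of_subset (future_subset t) (ha.add hb).coeFn_toLp
    filter_upwards [h1, ae_restrict_mem hfm] with x hx hxm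
    rw [hx]
    have : x ∉ past t := fun hy => not_lt.2 hxm hy.2
    simp [Set.indicator_of_mem hxm, Set.indicator_of_notMem this]

/-- The exponential vector `ε(f|_{[0,t)})`. -/
noncomputable def expPast (t : ℝ≥0) (f : L2 k half) : FockOn k (past t) :=
  expVec (res (past_subset t) f)

/-- The exponential vector `ε(f|_{[t,∞)})`. -/
noncomputable def expFuture (t : ℝ≥0) (f : L2 k half) : FockOn k (future t) :=
  expVec (res (future_subset t) f)

theorem inner_expVec_split (t : ℝ≥0) (f g : L2 k half) :
    ⟪expVec f, expVec g⟫_ℂ =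
      ⟪expPast t f, expPast t g⟫_ℂ * ⟪expFuture t f, expFuture t g⟫_ℂ := by
  simp only [expPast, expFuture]
  rw [inner_expVec, inner_expVec, inner_expVec, inner_split t, Complex.exp_add]

variable (k) in
/-- The isomorphism `𝓕 ≅ 𝓕_{t)} ⊗ 𝓕_{[t}` taking `ε(f)` to
`ε(f|_{[0,t)}) ⊗ ε(f|_{[t,∞)})`. -/
noncomputable def split (t : ℝ≥0) :
    FockOn k half ≃ₗᵢ[ℂ] HTensor (FockOn k (past t)) (FockOn k (future t)) :=
  gramUnitary expVec (fun f => tmul (expPast t f) (expFuture t f)) total_expVec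
    ((total_expVec.tmul total_expVec).mono (by
      rintro _ ⟨⟨a, b⟩, rfl⟩
      obtain ⟨f, rfl, rfl⟩ := exists_glue t a b
      exact ⟨f, rfl⟩))
    (fun f g => by rw [inner_tmul, inner_expVec_split t])

theorem split_expVec (t : ℝ≥0) (f : L2 k half) :
    split k t (expVec f) = tmul (expPast t f) (expFuture t f) :=
  gramUnitary_apply _ _ _ _ _ f

variable (k) in
theorem measurePreserving_shift (t : ℝ≥0) :
    MeasurePreserving (fun s : ℝ => s - t) (volume.restrict (future t))
      (volume.restrict half) := by
  have := (measurePreserving_sub_right (volume : Measure ℝ) (t : ℝ)).restrict_preimage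
    (measurableSet_Ici (a := (0 : ℝ)))
  simpa [future, half] using this

theorem measurePreserving_unshift (t : ℝ≥0) :
    MeasurePreserving (fun s : ℝ => s + t) (volume.restrict half)
      (volume.restrict (future t)) := by
  have := (measurePreserving_add_right (volume : Measure ℝ) (t : ℝ)).restrict_preimage
    (measurableSet_Ici (a := (t : ℝ)))
  simpa [future, half] using this

/-- The right shift `f ↦ f(· - t)`, as a unitary operator from `L²(ℝ₊; k)` onto
`L²([t, ∞); k)`. -/
noncomputable def shift (t : ℝ≥0) : L2 k half ≃ₗᵢ[ℂ] L2 k (future t) :=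
  LinearIsometryEquiv.ofSurjective
    (Lp.compMeasurePreservingₗᵢ ℂ (fun s : ℝ => s - t) (measurePreserving_shift t))
    (fun g => ⟨Lp.compMeasurePreserving (fun s : ℝ => s + t) (measurePreserving_unshift t) g, by
      refine Lp.ext ((Lp.coeFn_compMeasurePreserving _ (measurePreserving_shift t)).trans ?_)
      have h1 := (measurePreserving_shift t).quasiMeasurePreserving.ae_eq_comp
        (Lp.coeFn_compMeasurePreserving g (measurePreserving_unshift t))
      refine h1.trans (Filter.Eventually.of_forall fun s => ?_)
      simp⟩)

theorem coeFn_shift (t : ℝ≥0) (f : L2 k half) :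
    shift t f =ᵐ[volume.restrict (future t)] fun s => f (s - t) :=
  Lp.coeFn_compMeasurePreserving f (measurePreserving_shift t)

variable (k) in
/-- The second quantised shift `Γ_t`, as a unitary operator from `𝓕` onto `𝓕_{[t}`, with
`Γ_t ε(f) = ε(f(· - t))`. -/
noncomputable def Gam (t : ℝ≥0) : FockOn k half ≃ₗᵢ[ℂ] FockOn k (future t) :=
  gramUnitary expVec (fun f => expVec (shift t f)) total_expVec
    (total_expVec.mono (by
      rintro _ ⟨g, rfl⟩
      exact ⟨(shift t).symm g, by simp⟩))
    (fun f g => by rw [inner_expVec, inner_expVec, LinearIsometryEquiv.inner_map_map])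

theorem Gam_expVec (t : ℝ≥0) (f : L2 k half) : Gam k t (expVec f) = expVec (shift t f) :=
  gramUnitary_apply _ _ _ _ _ f

/-- The second quantisation of an orthogonal projection `p` on `k` acting pointwise on
`L²(A; k)`: the orthogonal projection onto the closed linear span of the vectors `ε(p f)`.
It satisfies `P ε(f) = ε(p f)`, which determines it. -/
noncomputable def quantProj (p : k →L[ℂ] k) (A : Set ℝ) : FockOn k A →L[ℂ] FockOn k A :=
  ((Submodule.span ℂ (Set.range fun f : L2 k A =>
    expVec (p.compLpL 2 (volume.restrict A) f))).topologicalClosure).starProjection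

theorem quantProj_expVec {p : k →L[ℂ] k} (hp : IsStarProjection p) (A : Set ℝ) (f : L2 k A) :
    quantProj p A (expVec f) = expVec (p.compLpL 2 (volume.restrict A) f) := by
  refine Submodule.eq_starProjection_of_mem_orthogonal
    (Submodule.le_topologicalClosure _ (Submodule.subset_span ⟨f, rfl⟩)) ?_
  rw [Submodule.orthogonal_closure, Submodule.mem_orthogonal]
  intro w hw
  induction hw using Submodule.span_induction with
  | mem w hw =>
    obtain ⟨g, rfl⟩ := hw
    have hpp : ∀ x y : k, ⟪p x, p y⟫_ℂ = ⟪p x, y⟫_ℂ := by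
      intro x y
      have h1 : ContinuousLinearMap.adjoint p = p := hp.isSelfAdjoint
      have h2 : p (p x) = p x := congrArg (fun T : k →L[ℂ] k => T x) hp.isIdempotentElem
      rw [← ContinuousLinearMap.adjoint_inner_left, h1, h2]
    have h3 : ⟪p.compLpL 2 (volume.restrict A) g, p.compLpL 2 (volume.restrict A) f⟫_ℂ =
        ⟪p.compLpL 2 (volume.restrict A) g, f⟫_ℂ := by
      rw [L2.inner_def, L2.inner_def]
      refine integral_congr_ae ?_
      filter_upwards [p.coeFn_compLpL (p := 2) (μ := volume.restrict A) g,
        p.coeFn_compLpL (p := 2) (μ := volume.restrict A) f] with x hg hf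
      rw [hg, hf, hpp]
    rw [inner_sub_right, inner_expVec, inner_expVec, h3, sub_self]
  | zero => exact inner_zero_left _
  | add a b _ _ ha hb => rw [inner_add_left, ha, hb, add_zero]
  | smul c a _ ha => rw [inner_smul_left, ha, mul_zero]

end HalfLine

section StopTime

variable (k : Type u) [NormedAddCommGroup k] [InnerProductSpace ℂ k] [CompleteSpace k]

/-- A quantum stop time: an identity-adapted spectral measure on `[0, ∞]` acting on Fock space. -/
structure QuantumStopTime where
  /-- the operator `S(A)` for each Borel set `A` (its values at other sets play no role) -/
  proj : Set ℝ≥0∞ → (FockOn k half →L[ℂ] FockOn k half)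
  isStarProjection : ∀ A, MeasurableSet A → IsStarProjection (proj A)
  isMeasure : ∀ x y : FockOn k half, ∃ μ : ComplexMeasure ℝ≥0∞,
    ∀ A, MeasurableSet A → μ A = ⟪x, proj A y⟫_ℂ
  proj_univ : proj Set.univ = 1
  proj_zero : ∃ c : ℂ, proj {0} = c • 1
  adapted : ∀ t : ℝ≥0, 0 < t → ∃ T : FockOn k (past t) →L[ℂ] FockOn k (past t),
    proj (Set.Icc 0 (t : ℝ≥0∞)) = pull (split k t) (tmap T 1)

variable {k} in
/-- The standing requirements `S({0}) = 0` and `S({∞}) = 0`. -/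
def QuantumStopTime.IsFinite (S : QuantumStopTime k) : Prop :=
  S.proj {0} = 0 ∧ S.proj {⊤} = 0

end StopTime

section Cocycle

variable {k : Type u} [NormedAddCommGroup k] [InnerProductSpace ℂ k] [CompleteSpace k]
variable {ini : Type v} [NormedAddCommGroup ini] [InnerProductSpace ℂ ini] [CompleteSpace ini]

variable (k ini) in
/-- The isomorphism `ini ⊗ 𝓕 ≅ (ini ⊗ 𝓕_{t)}) ⊗ 𝓕_{[t}` taking `u ⊗ ε(f)` to
`(u ⊗ ε(f|_{[0,t)})) ⊗ ε(f|_{[t,∞)})`. -/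
noncomputable def splitIni (t : ℝ≥0) : HTensor ini (FockOn k half) ≃ₗᵢ[ℂ]
    HTensor (HTensor ini (FockOn k (past t))) (FockOn k (future t)) :=
  gramUnitary (fun z : ini × L2 k half => tmul z.1 (expVec z.2))
    (fun z => tmul (tmul z.1 (expPast t z.2)) (expFuture t z.2))
    (total_id.tmul total_expVec)
    (((total_id.tmul total_expVec).tmul total_expVec).mono (by
      rintro _ ⟨⟨⟨u, a⟩, b⟩, rfl⟩
      obtain ⟨f, rfl, rfl⟩ := exists_glue t a b
      exact ⟨(u, f), rfl⟩))
    (fun z w => by simp only [inner_tmul]; rw [inner_expVec_split t, mul_assoc])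

theorem splitIni_tmul (t : ℝ≥0) (u : ini) (f : L2 k half) :
    splitIni k ini t (tmul u (expVec f)) = tmul (tmul u (expPast t f)) (expFuture t f) :=
  gramUnitary_apply _ _ _ _ _ (u, f)

variable (k ini) in
/-- The isomorphism `ini ⊗ 𝓕 ≅ 𝓕_{t)} ⊗ (ini ⊗ 𝓕_{[t})` taking `u ⊗ ε(f)` to
`ε(f|_{[0,t)}) ⊗ (u ⊗ ε(f|_{[t,∞)}))`. -/
noncomputable def splitFlow (t : ℝ≥0) : HTensor ini (FockOn k half) ≃ₗᵢ[ℂ]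
    HTensor (FockOn k (past t)) (HTensor ini (FockOn k (future t))) :=
  gramUnitary (fun z : ini × L2 k half => tmul z.1 (expVec z.2))
    (fun z => tmul (expPast t z.2) (tmul z.1 (expFuture t z.2)))
    (total_id.tmul total_expVec)
    ((total_expVec.tmul (total_id.tmul total_expVec)).mono (by
      rintro _ ⟨⟨a, ⟨u, b⟩⟩, rfl⟩
      obtain ⟨f, rfl, rfl⟩ := exists_glue t a b
      exact ⟨(u, f), rfl⟩))
    (fun z w => by simp only [inner_tmul]; rw [inner_expVec_split t, mul_left_comm])

theorem splitFlow_tmul (t : ℝ≥0) (u : ini) (f : L2 k half) :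
    splitFlow k ini t (tmul u (expVec f)) = tmul (expPast t f) (tmul u (expFuture t f)) :=
  gramUnitary_apply _ _ _ _ _ (u, f)

/-- The CCR flow, extended by ampliation: `σ_t(X) = I_{t)} ⊗ Γ_t X Γ_t*`, where `X` acts on
`ini ⊗ 𝓕`, where `Γ_t : 𝓕 → 𝓕_{[t}` is ampliated to `ini ⊗ 𝓕` and where `ini ⊗ 𝓕` is identified
with `𝓕_{t)} ⊗ (ini ⊗ 𝓕_{[t})`. -/
noncomputable def ccrFlow (t : ℝ≥0)
    (X : HTensor ini (FockOn k half) →L[ℂ] HTensor ini (FockOn k half)) :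
    HTensor ini (FockOn k half) →L[ℂ] HTensor ini (FockOn k half) :=
  pull (splitFlow k ini t) (tmap (1 : FockOn k (past t) →L[ℂ] FockOn k (past t))
    (tmap (1 : ini →L[ℂ] ini)
        ((Gam k t).toContinuousLinearEquiv : FockOn k half →L[ℂ] FockOn k (future t)) ∘L X ∘L
      tmap (1 : ini →L[ℂ] ini)
        ((Gam k t).symm.toContinuousLinearEquiv : FockOn k (future t) →L[ℂ] FockOn k half)))

/-- The von Neumann algebra generated by a set of operators: its double commutant, each commutant
being taken of the set together with the adjoints of its elements. -/
noncomputable def vnGenerated {H : Type*} [NormedAddCommGroup H] [InnerProductSpace ℂ H]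
    [CompleteSpace H] (s : Set (H →L[ℂ] H)) : VonNeumannAlgebra H where
  toStarSubalgebra := StarSubalgebra.centralizer ℂ
    (StarSubalgebra.centralizer ℂ s : Set (H →L[ℂ] H))
  centralizer_centralizer' := by simp

/-- The ultraweak tensor product `𝒜 ⊗ B(K)`: the von Neumann algebra on `ini ⊗ K` generated by the
operators `a ⊗ b` with `a ∈ 𝒜` and `b ∈ B(K)`. -/
noncomputable def vnTensor (𝒜 : VonNeumannAlgebra ini) (K : Type*) [NormedAddCommGroup K]
    [InnerProductSpace ℂ K] [CompleteSpace K] : VonNeumannAlgebra (HTensor ini K) :=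
  vnGenerated {X | ∃ a ∈ 𝒜, ∃ b : K →L[ℂ] K, X = tmap a b}

variable (k) in
/-- A `p`-adapted process in `𝒜 ⊗ B(𝓕)`: a family of operators `V_t = V_{t)} ⊗ P_{[t}` with
`V_{t)} ∈ 𝒜 ⊗ B(𝓕_{t)})`. As `P_{[t} ≠ 0`, the operators `V_{t)}` are determined by `V`. -/
structure AdaptedProcess (𝒜 : VonNeumannAlgebra ini) (p : k →L[ℂ] k) where
  /-- the operators `V_t` -/
  op : ℝ≥0 → (HTensor ini (FockOn k half) →L[ℂ] HTensor ini (FockOn k half))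
  /-- the operators `V_{t)}` -/
  pre : ∀ t : ℝ≥0, HTensor ini (FockOn k (past t)) →L[ℂ] HTensor ini (FockOn k (past t))
  op_mem : ∀ t, op t ∈ vnTensor 𝒜 (FockOn k half)
  pre_mem : ∀ t, pre t ∈ vnTensor 𝒜 (FockOn k (past t))
  op_eq : ∀ t, op t = pull (splitIni k ini t) (tmap (pre t) (quantProj p (future t)))

namespace AdaptedProcess

variable {𝒜 : VonNeumannAlgebra ini} {p : k →L[ℂ] k}

/-- The identity-adapted projection `V̂_t = V_{t)} ⊗ I_{[t}`. -/
noncomputable def hat (V : AdaptedProcess k 𝒜 p) (t : ℝ≥0) :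
    HTensor ini (FockOn k half) →L[ℂ] HTensor ini (FockOn k half) :=
  pull (splitIni k ini t) (tmap (V.pre t) 1)

/-- The cocycle property `V_{s+t} = V̂_s σ_s(V_t)`. -/
def IsCocycle (V : AdaptedProcess k 𝒜 p) : Prop :=
  ∀ s t : ℝ≥0, V.op (s + t) = V.hat s ∘L ccrFlow s (V.op t)

/-- The process is isometric if `V_{t)}* V_{t)} = I` for all `t`. -/
def IsIsometric (V : AdaptedProcess k 𝒜 p) : Prop :=
  ∀ t : ℝ≥0, ContinuousLinearMap.adjoint (V.pre t) ∘L V.pre t = 1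

/-- Strong continuity: `t ↦ V_t z` is continuous for every vector `z`. -/
def IsStronglyContinuous (V : AdaptedProcess k 𝒜 p) : Prop :=
  ∀ z, Continuous fun t => V.op t z

end AdaptedProcess

/-- A finite partition `{0 = π₀ < ⋯ < πₙ₊₁ = t}` of `[0, t]`, given by its set of points. -/
structure Partition (t : ℝ≥0) where
  points : Finset ℝ≥0
  zero_mem : 0 ∈ points
  end_mem : t ∈ points
  le_end : ∀ x ∈ points, x ≤ t

namespace Partition

variable {t : ℝ≥0}

/-- Partitions are ordered by refinement. -/
instance : PartialOrder (Partition t) :=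
  PartialOrder.lift Partition.points fun a b h => by cases a; cases b; congr

instance : Nonempty (Partition t) := ⟨⟨{0, t}, by simp, by simp, by simp⟩⟩

instance : IsDirectedOrder (Partition t) where
  directed a b := ⟨⟨a.points ∪ b.points, Finset.mem_union_left _ a.zero_mem,
    Finset.mem_union_left _ a.end_mem, fun x hx =>
      (Finset.mem_union.1 hx).elim (a.le_end x) (b.le_end x)⟩,
    Finset.subset_union_left, Finset.subset_union_right⟩

/-- The point `π_{j-1}` of the partition that precedes `x = π_j`, the largest point of the
partition that is smaller than `x`. -/
noncomputable def pred (π : Partition t) (x : ℝ≥0) : ℝ≥0 := (π.points.filter (· < x)).sup id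

end Partition

variable (ini) in
/-- The operator `S(A)`, extended by ampliation to act on `ini ⊗ 𝓕`. -/
noncomputable def QuantumStopTime.amp (S : QuantumStopTime k) (A : Set ℝ≥0∞) :
    HTensor ini (FockOn k half) →L[ℂ] HTensor ini (FockOn k half) :=
  tmap (1 : ini →L[ℂ] ini) (S.proj A)

/-- The Riemann sum `V_{S,π} = ∑_{j=1}^{n+1} V_{π_j} S((π_{j-1}, π_j])`. -/
noncomputable def riemannSum
    (V : ℝ≥0 → (HTensor ini (FockOn k half) →L[ℂ] HTensor ini (FockOn k half)))
    (S : QuantumStopTime k) {t : ℝ≥0} (π : Partition t) :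
    HTensor ini (FockOn k half) →L[ℂ] HTensor ini (FockOn k half) :=
  ∑ x ∈ π.points.erase 0, V x ∘L S.amp ini (Set.Ioc (π.pred x : ℝ≥0∞) (x : ℝ≥0∞))

end Cocycle

end QStop

/-! The terms of a Riemann sum are mutually orthogonal, and everything follows from this. For `s ≤
t` the cocycle identity gives both `V_s = V̂_s σ_s(V_0)` and `V_t = V̂_s σ_s(V_{t-s})`. In an inner
product of `V_s S((a,b]) x` with `V_t S(B) y`, where `b ≤ s` and `B` is disjoint from `(a,b]`, the
common isometry `V̂_s` cancels. The projection `S((a,b])` has the form `T ⊗ I_{[s}`, so it commutes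
with the range of `σ_s`; it can be moved to the right-hand vector, where it meets `S(B)` and gives
zero (`inner_op_amp_eq_zero`).

By Pythagoras the Riemann sums are contractions (`norm_rsum_le`), so convergence need only be
checked on the vectors `u ⊗ ε(f)`. If `π'` refines `π`, the difference of the two sums is an
orthogonal sum over the cells of `π'`, each term being an increment of `V` over a time at most the
mesh of `π`, applied to `S(cell) z`. On `u ⊗ ε(f)` such an increment is controlled by `(V_r - V_0)(u
⊗ ε(f(· + s)))` with `r` small. This is small uniformly in `s ≤ t` by strong continuity and
compactness (`exists_small`). The relative bound `ε ‖S(cell) z‖` on each term sums in squares to at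
most `ε² ‖z‖²`, so the net is Cauchy.

For the limit in `t`, `V_{S,t} S([0,s]) = V_{S,s}` when `s ≤ t`. Hence the squared norm of `V_{S,t}
z - V_{S,s} z` is at most the increment of the bounded monotone function `‖S([0,t]) z‖²`. The
structure `IsStoppable` isolates what this argument needs, and `IsStoppable.exists_limit` carries it
out. -/

namespace QStop

universe u v

/-! ### Operators on Hilbert space tensor products and transport by unitaries. -/

section Operators

variable {E : Type*} [NormedAddCommGroup E] [InnerProductSpace ℂ E]
variable {F : Type*} [NormedAddCommGroup F] [InnerProductSpace ℂ F]
variable {E' : Type*} [NormedAddCommGroup E'] [InnerProductSpace ℂ E']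
variable {F' : Type*} [NormedAddCommGroup F'] [InnerProductSpace ℂ F']
variable {E'' : Type*} [NormedAddCommGroup E''] [InnerProductSpace ℂ E'']
variable {F'' : Type*} [NormedAddCommGroup F''] [InnerProductSpace ℂ F'']

/-- A closed subspace containing a total family is the whole space. -/
theorem Total.eq_top {ι : Type*} {a : ι → E} (ha : Total a) {W : Submodule ℂ E}
    (hW : IsClosed (W : Set E)) (h : ∀ i, a i ∈ W) : W = ⊤ := by
  rw [eq_top_iff, ← (show (Submodule.span ℂ (Set.range a)).topologicalClosure = ⊤ from ha)]
  refine Submodule.topologicalClosure_minimal _ (Submodule.span_le.2 ?_) hW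
  rintro _ ⟨i, rfl⟩
  exact h i

theorem Total.clm_ext {ι : Type*} {a : ι → E} (ha : Total a) {A B : E →L[ℂ] F}
    (h : ∀ i, A (a i) = B (a i)) : A = B := by
  have hW : IsClosed ((A : E →ₗ[ℂ] F).eqLocus (B : E →ₗ[ℂ] F) : Set E) :=
    isClosed_eq A.continuous B.continuous
  have := ha.eq_top hW fun i => h i
  ext z
  have hz : z ∈ (A : E →ₗ[ℂ] F).eqLocus (B : E →ₗ[ℂ] F) := this ▸ Submodule.mem_top
  exact hz

/-- A bounded operator is determined by its matrix elements on a total family. -/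
theorem Total.clm_ext_inner {ι : Type*} {a : ι → E} (ha : Total a) {A B : E →L[ℂ] E}
    (h : ∀ i j, ⟪a i, A (a j)⟫_ℂ = ⟪a i, B (a j)⟫_ℂ) : A = B := by
  refine ha.clm_ext fun j => ?_
  have : innerSL ℂ (A (a j)) = innerSL ℂ (B (a j)) := ha.clm_ext fun i => by
    rw [innerSL_apply_apply, innerSL_apply_apply, ← inner_conj_symm, h, inner_conj_symm]
  exact ext_inner_right ℂ fun v => by
    simpa using congrArg (fun T : E →L[ℂ] ℂ => T v) this

theorem total_tmul : Total fun z : E × F => tmul z.1 z.2 :=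
  Total.tmul (a := fun x : E => x) (b := fun y : F => y) total_id total_id

theorem norm_tmul (x : E) (y : F) : ‖tmul x y‖ = ‖x‖ * ‖y‖ := by
  rw [tmul, UniformSpace.Completion.norm_coe, TensorProduct.norm_tmul]

theorem norm_tmap_le (A : E →L[ℂ] E') (B : F →L[ℂ] F') : ‖tmap A B‖ ≤ ‖A‖ * ‖B‖ := by
  refine ContinuousLinearMap.opNorm_le_bound _ (by positivity) fun z => ?_
  induction z using UniformSpace.Completion.induction_on with
  | hp => exact isClosed_le (by fun_prop) (by fun_prop)
  | ih z =>
    have h1 : tmap A B (z : HTensor E F) = ((TensorProduct.mapL A B z : E' ⊗[ℂ] F') :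
        HTensor E' F') := by simp [tmap]
    rw [h1, UniformSpace.Completion.norm_coe, UniformSpace.Completion.norm_coe]
    exact (TensorProduct.mapL A B).le_of_opNorm_le (TensorProduct.norm_mapL_le A B) z

theorem tmap_comp (A : E' →L[ℂ] E'') (B : F' →L[ℂ] F'') (A' : E →L[ℂ] E') (B' : F →L[ℂ] F') :
    tmap A B ∘L tmap A' B' = tmap (A ∘L A') (B ∘L B') :=
  total_tmul.clm_ext fun z => by simp [tmap_tmul]

theorem tmap_add_right (A : E →L[ℂ] E') (B B' : F →L[ℂ] F') :
    tmap A (B + B') = tmap A B + tmap A B' :=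
  total_tmul.clm_ext fun z => by simp [tmap_tmul, tmul_add]

theorem tmap_one_one : tmap (1 : E →L[ℂ] E) (1 : F →L[ℂ] F) = 1 :=
  total_tmul.clm_ext fun z => by simp [tmap_tmul]

theorem tmul_sub (x : E) (y y' : F) : tmul x (y - y') = tmul x y - tmul x y' := by
  rw [eq_sub_iff_add_eq, ← tmul_add, sub_add_cancel]

theorem adjoint_tmap [CompleteSpace E] [CompleteSpace F] [CompleteSpace E'] [CompleteSpace F']
    (A : E →L[ℂ] E') (B : F →L[ℂ] F') :
    ContinuousLinearMap.adjoint (tmap A B) =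
      tmap (ContinuousLinearMap.adjoint A) (ContinuousLinearMap.adjoint B) := by
  refine total_tmul.clm_ext fun z => ?_
  have key : innerSL ℂ (ContinuousLinearMap.adjoint (tmap A B) (tmul z.1 z.2)) =
      innerSL ℂ (tmap (ContinuousLinearMap.adjoint A) (ContinuousLinearMap.adjoint B)
        (tmul z.1 z.2)) := total_tmul.clm_ext fun w => by
    simp only [innerSL_apply_apply, ContinuousLinearMap.adjoint_inner_left, tmap_tmul,
      inner_tmul]
  exact ext_inner_right ℂ fun v => by
    simpa using congrArg (fun T : HTensor E F →L[ℂ] ℂ => T v) key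

theorem norm_tmap_one_right [CompleteSpace E] [CompleteSpace F] {A : E →L[ℂ] E}
    (hA : ContinuousLinearMap.adjoint A ∘L A = 1) (z : HTensor E F) :
    ‖tmap A (1 : F →L[ℂ] F) z‖ = ‖z‖ := by
  have h1 : ContinuousLinearMap.adjoint (tmap A (1 : F →L[ℂ] F)) ∘L
      tmap A (1 : F →L[ℂ] F) = 1 := by
    rw [adjoint_tmap, tmap_comp, hA,
      show ContinuousLinearMap.adjoint (1 : F →L[ℂ] F) = 1 from star_one _]
    exact tmap_one_one
  exact (ContinuousLinearMap.norm_map_iff_adjoint_comp_self _).2 h1 z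

theorem isStarProjection_tmap_one [CompleteSpace E] [CompleteSpace F] {P : F →L[ℂ] F}
    (hP : IsStarProjection P) : IsStarProjection (tmap (1 : E →L[ℂ] E) P) := by
  constructor
  · refine (tmap_comp _ _ _ _).trans ?_
    rw [show P ∘L P = P from hP.isIdempotentElem]
    rfl
  · refine (adjoint_tmap _ _).trans ?_
    rw [show ContinuousLinearMap.adjoint P = P from hP.isSelfAdjoint,
      show ContinuousLinearMap.adjoint (1 : E →L[ℂ] E) = 1 from star_one _]

theorem pull_comp (U : E ≃ₗᵢ[ℂ] F) (A B : F →L[ℂ] F) :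
    pull U A ∘L pull U B = pull U (A ∘L B) := by
  ext z
  simp [pull_apply]

theorem norm_pull_apply (U : E ≃ₗᵢ[ℂ] F) (A : F →L[ℂ] F) (x : E) :
    ‖pull U A x‖ = ‖A (U x)‖ := by
  rw [pull_apply, LinearIsometryEquiv.norm_map]

theorem inner_pull (U : E ≃ₗᵢ[ℂ] F) (A : F →L[ℂ] F) (x y : E) :
    ⟪x, pull U A y⟫_ℂ = ⟪U x, A (U y)⟫_ℂ := by
  rw [← U.inner_map_map, pull_apply, U.apply_symm_apply]

theorem norm_pull_le (U : E ≃ₗᵢ[ℂ] F) (A : F →L[ℂ] F) : ‖pull U A‖ ≤ ‖A‖ :=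
  ContinuousLinearMap.opNorm_le_bound _ (norm_nonneg _) fun x => by
    rw [norm_pull_apply, ← U.norm_map x]
    exact A.le_opNorm _

theorem pull_sub (U : E ≃ₗᵢ[ℂ] F) (A B : F →L[ℂ] F) : pull U (A - B) = pull U A - pull U B := by
  ext z
  simp [pull_apply]

end Operators

/-! ### Adapted operators on Fock space and the CCR flow. -/

section Adapted

variable {k : Type u} [NormedAddCommGroup k] [InnerProductSpace ℂ k] [CompleteSpace k]
variable {ini : Type v} [NormedAddCommGroup ini] [InnerProductSpace ℂ ini] [CompleteSpace ini]

/-- An operator on Fock space is adapted at time `t` if it is of the form `T ⊗ I_{[t}`. -/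
def IsAdaptedAt (t : ℝ≥0) (X : FockOn k half →L[ℂ] FockOn k half) : Prop :=
  ∃ T : FockOn k (past t) →L[ℂ] FockOn k (past t), X = pull (split k t) (tmap T 1)

theorem IsAdaptedAt.sub {t : ℝ≥0} {X Y : FockOn k half →L[ℂ] FockOn k half}
    (hX : IsAdaptedAt t X) (hY : IsAdaptedAt t Y) : IsAdaptedAt t (X - Y) := by
  obtain ⟨T, rfl⟩ := hX
  obtain ⟨T', rfl⟩ := hY
  refine ⟨T - T', ?_⟩
  rw [← pull_sub]
  congr 1
  refine total_tmul.clm_ext fun z => ?_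
  simp only [tmap_tmul, sub_apply]
  rw [sub_eq_iff_eq_add, ← add_tmul, sub_add_cancel]

theorem isAdaptedAt_smul_one (t : ℝ≥0) (c : ℂ) :
    IsAdaptedAt t (c • (1 : FockOn k half →L[ℂ] FockOn k half)) := by
  refine ⟨c • 1, total_expVec.clm_ext fun f => ?_⟩
  rw [pull_apply, split_expVec, tmap_tmul, LinearIsometryEquiv.eq_symm_apply]
  simp [smul_tmul, split_expVec]

/-- Exponential vectors factorise over past and future, so adaptedness is visible in matrix
elements. With `Total.clm_ext_inner` this reduces operator identities to identities between
exponents. -/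
theorem inner_expVec_adapted {t : ℝ≥0} (T : FockOn k (past t) →L[ℂ] FockOn k (past t))
    (f g : L2 k half) :
    ⟪expVec g, pull (split k t) (tmap T 1) (expVec f)⟫_ℂ =
      ⟪expPast t g, T (expPast t f)⟫_ℂ *
        Complex.exp ⟪res (future_subset t) g, res (future_subset t) f⟫_ℂ := by
  rw [inner_pull, split_expVec, split_expVec, tmap_tmul, inner_tmul]
  congr 1
  exact inner_expVec _ _

theorem res_res {A B C : Set ℝ} (hAB : A ⊆ B) (hBC : B ⊆ C) (f : L2 k C) :
    res hAB (res hBC f) = res (hAB.trans hBC) f := by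
  refine Lp.ext ((coeFn_res hAB (res hBC f)).trans ?_)
  exact EventuallyEq.trans (ae_restrict_of_ae_restrict_of_subset hAB (coeFn_res hBC f))
    (coeFn_res (hAB.trans hBC) f).symm

theorem past_mono {s t : ℝ≥0} (hst : s ≤ t) : past s ⊆ past t :=
  Set.Ico_subset_Ico_right (NNReal.coe_le_coe.2 hst)

/-- The witness is the compression of `X` to `𝓕_{t)} ⊗ ε(0)`, a copy of `𝓕_{t)}`. That it represents
`X` on all of Fock space is checked on exponential vectors. -/
theorem IsAdaptedAt.mono {s t : ℝ≥0} (hst : s ≤ t) {X : FockOn k half →L[ℂ] FockOn k half}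
    (hX : IsAdaptedAt s X) : IsAdaptedAt t X := by
  obtain ⟨T, hT⟩ := hX
  let W : FockOn k (past t) →ₗᵢ[ℂ] FockOn k half :=
    { toLinearMap :=
        { toFun := fun x => (split k t).symm (tmul x (expVec 0))
          map_add' := fun x y => by rw [add_tmul, map_add]
          map_smul' := fun c x => by rw [smul_tmul, map_smul]; rfl }
      norm_map' := fun x => by
        have h1 : ‖(expVec (0 : L2 k (future t)) : FockOn k (future t))‖ = 1 := by
          rw [@norm_eq_sqrt_re_inner ℂ, inner_expVec]
          simp
        change ‖(split k t).symm (tmul x (expVec 0))‖ = ‖x‖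
        rw [LinearIsometryEquiv.norm_map, norm_tmul, h1, mul_one] }
  have hW : ∀ f : L2 k half, res (future_subset t) f = 0 → W (expPast t f) = expVec f := by
    intro f hf
    change (split k t).symm (tmul (expPast t f) (expVec 0)) = expVec f
    rw [LinearIsometryEquiv.symm_apply_eq, split_expVec, expFuture, hf]
  refine ⟨ContinuousLinearMap.adjoint W.toContinuousLinearMap ∘L X ∘L W.toContinuousLinearMap,
    total_expVec.clm_ext_inner fun g f => ?_⟩
  -- Cut `g` and `f` off to zero after time `t`, so that their exponential vectors lie in the range
  -- of `W`.
  obtain ⟨g', hg, hg0⟩ := exists_glue t (res (past_subset t) g) 0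
  obtain ⟨f', hf, hf0⟩ := exists_glue t (res (past_subset t) f) 0
  have eg : expPast t g = expPast t g' := by rw [expPast, expPast, hg]
  have ef : expPast t f = expPast t f' := by rw [expPast, expPast, hf]
  have rg : res (past_subset s) g' = res (past_subset s) g := by
    rw [← res_res (past_mono hst) (past_subset t), hg, res_res]
  have rf : res (past_subset s) f' = res (past_subset s) f := by
    rw [← res_res (past_mono hst) (past_subset t), hf, res_res]
  rw [inner_expVec_adapted]
  simp only [ContinuousLinearMap.comp_apply, ContinuousLinearMap.adjoint_inner_right]
  rw [eg, ef]
  simp only [LinearIsometry.coe_toContinuousLinearMap]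
  rw [hW _ hg0, hW _ hf0, hT, inner_expVec_adapted, inner_expVec_adapted, mul_assoc,
    ← Complex.exp_add]
  simp only [expPast, rg, rf]
  -- What remains is additivity of the inner product over `[s,∞) = [s,t) ∪ [t,∞)`; the part over
  -- `[s,t)` is seen through the truncated functions.
  congr 2
  have h1 := inner_split s g' f'
  have h2 := inner_split t g' f'
  have h3 := inner_split s g f
  have h4 := inner_split t g f
  rw [hg0, hf0, inner_zero_left, hg, hf] at h2
  rw [rg, rf] at h1
  linear_combination h1 - h2 - h3 + h4

theorem total_tmul_expVec {A : Set ℝ} :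
    Total fun z : ini × L2 k A => tmul z.1 (expVec z.2) :=
  total_id.tmul total_expVec

/-- The ampliation of an adapted operator acts on the first factor of
`𝓕_{t)} ⊗ (ini ⊗ 𝓕_{[t})`. -/
theorem tmap_one_pull_split (t : ℝ≥0) (T : FockOn k (past t) →L[ℂ] FockOn k (past t)) :
    tmap (1 : ini →L[ℂ] ini) (pull (split k t) (tmap T 1)) =
      pull (splitFlow k ini t) (tmap T 1) := by
  refine total_tmul_expVec.clm_ext_inner fun z w => ?_
  rw [tmap_tmul, inner_tmul, inner_pull, inner_pull, split_expVec, split_expVec, splitFlow_tmul,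
    splitFlow_tmul, tmap_tmul, tmap_tmul, inner_tmul, inner_tmul]
  simp only [one_apply_eq_self]
  rw [inner_tmul]
  ring

/-- In `𝓕_{t)} ⊗ (ini ⊗ 𝓕_{[t})` the adapted operator acts on the first factor and the flow on the
second. -/
theorem IsAdaptedAt.comp_ccrFlow {t : ℝ≥0} {X : FockOn k half →L[ℂ] FockOn k half}
    (hX : IsAdaptedAt t X) (Y : HTensor ini (FockOn k half) →L[ℂ] HTensor ini (FockOn k half)) :
    tmap 1 X ∘L ccrFlow t Y = ccrFlow t Y ∘L tmap 1 X := by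
  obtain ⟨T, rfl⟩ := hX
  rw [tmap_one_pull_split, ccrFlow, pull_comp, pull_comp, tmap_comp, tmap_comp]
  rfl

theorem Gam_symm_expVec (t : ℝ≥0) (f : L2 k (future t)) :
    (Gam k t).symm (expVec f) = expVec ((shift t).symm f) := by
  rw [LinearIsometryEquiv.symm_apply_eq, Gam_expVec, LinearIsometryEquiv.apply_symm_apply]

theorem one_le_norm_expVec {h : Type*} [NormedAddCommGroup h] [InnerProductSpace ℂ h] (f : h) :
    1 ≤ ‖expVec f‖ := by
  rw [@norm_eq_sqrt_re_inner ℂ, inner_expVec, inner_self_eq_norm_sq_to_K, Real.one_le_sqrt]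
  have : Complex.exp ((‖f‖ : ℂ) ^ 2) = (Real.exp (‖f‖ ^ 2) : ℂ) := by push_cast; rfl
  refine (Real.one_le_exp (sq_nonneg ‖f‖)).trans_eq ?_
  exact (congrArg Complex.re this).symm

/-- The left shift `f ↦ f(· + t)` on `L²(ℝ₊; k)`. -/
noncomputable def leftShift (t : ℝ≥0) (f : L2 k half) : L2 k half :=
  (shift t).symm (res (future_subset t) f)

/-- With `X = T ⊗ I`, the vector on the left is an elementary tensor: `T ε(f|_{[0,t)})` times a
shifted copy of `(Y - Z)(u ⊗ ε(f(· + t)))`. The factor `‖u‖` allows the norm of `T ε(f|_{[0,t)})` to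
be replaced by that of `X (u ⊗ ε(f))`, because `‖ε(f|_{[t,∞)})‖ ≥ 1`. -/
theorem norm_ccrFlow_sub_le {t : ℝ≥0} {X : FockOn k half →L[ℂ] FockOn k half}
    (hX : IsAdaptedAt t X) (Y Z : HTensor ini (FockOn k half) →L[ℂ] HTensor ini (FockOn k half))
    (u : ini) (f : L2 k half) :
    ‖ccrFlow t Y (tmap 1 X (tmul u (expVec f))) - ccrFlow t Z (tmap 1 X (tmul u (expVec f)))‖ *
      ‖u‖ ≤ ‖tmap (1 : ini →L[ℂ] ini) X (tmul u (expVec f))‖ *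
        ‖Y (tmul u (expVec (leftShift t f))) - Z (tmul u (expVec (leftShift t f)))‖ := by
  obtain ⟨T, rfl⟩ := hX
  have h1 : ‖tmap (1 : ini →L[ℂ] ini) ((Gam k t).toContinuousLinearEquiv :
      FockOn k half →L[ℂ] FockOn k (future t))‖ ≤ 1 := by
    refine (norm_tmap_le _ _).trans ?_
    refine mul_le_one₀ ContinuousLinearMap.norm_id_le (norm_nonneg _) ?_
    exact ContinuousLinearMap.opNorm_le_bound _ zero_le_one fun x => by
      rw [one_mul]; exact ((Gam k t).norm_map x).le
  rw [tmap_one_pull_split, norm_pull_apply, pull_apply, splitFlow_tmul, ccrFlow, ccrFlow,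
    pull_apply, pull_apply, ← map_sub, LinearIsometryEquiv.norm_map,
    LinearIsometryEquiv.apply_symm_apply]
  simp only [tmap_tmul, ContinuousLinearMap.comp_apply, one_apply_eq_self]
  have h2 : ((Gam k t).symm.toContinuousLinearEquiv : FockOn k (future t) →L[ℂ] FockOn k half)
      (expFuture t f) = expVec (leftShift t f) := Gam_symm_expVec t _
  rw [h2, ← tmul_sub, ← map_sub, norm_tmul, norm_tmul, norm_tmul]
  have h3 := ContinuousLinearMap.le_of_opNorm_le _ h1
    (Y (tmul u (expVec (leftShift t f))) - Z (tmul u (expVec (leftShift t f))))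
  have h4 := one_le_norm_expVec (res (future_subset t) f)
  rw [one_mul] at h3
  have h5 : ‖u‖ ≤ ‖u‖ * ‖expFuture t f‖ := le_mul_of_one_le_right (norm_nonneg _) h4
  rw [mul_assoc, mul_assoc]
  refine mul_le_mul_of_nonneg_left ?_ (norm_nonneg _)
  rw [mul_comm]
  exact mul_le_mul h5 h3 (norm_nonneg _) (by positivity)

end Adapted

/-! ### Orthogonal sums. -/

section Convergence

variable {H : Type*} [NormedAddCommGroup H] [InnerProductSpace ℂ H]

theorem norm_sq_sum_of_orthogonal {ι : Type*} (s : Finset ι) (x : ι → H)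
    (h : ∀ i ∈ s, ∀ j ∈ s, i ≠ j → ⟪x i, x j⟫_ℂ = 0) :
    ‖∑ i ∈ s, x i‖ ^ 2 = ∑ i ∈ s, ‖x i‖ ^ 2 := by
  have h1 : (⟪∑ i ∈ s, x i, ∑ i ∈ s, x i⟫_ℂ) = ∑ i ∈ s, ⟪x i, x i⟫_ℂ := by
    rw [sum_inner]
    refine Finset.sum_congr rfl fun i hi => ?_
    rw [inner_sum, Finset.sum_eq_single_of_mem i hi fun j hj hij => h i hi j hj hij.symm]
  simp only [inner_self_eq_norm_sq_to_K] at h1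
  exact_mod_cast h1

/-! ### Combinatorics of partitions, their cells and refinements. -/

namespace Partition

variable {t : ℝ≥0}

/-- The smallest point of the partition that is at least `u`. -/
noncomputable def next (π : Partition t) (u : ℝ≥0) : ℝ≥0 := sInf {x | x ∈ π.points ∧ u ≤ x}

/-- The half-open interval `(π_{j-1}, π_j]` with right endpoint `x = π_j`. -/
def cell (π : Partition t) (x : ℝ≥0) : Set ℝ≥0∞ := Set.Ioc (π.pred x : ℝ≥0∞) (x : ℝ≥0∞)

theorem measurableSet_cell (π : Partition t) (x : ℝ≥0) : MeasurableSet (π.cell x) :=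
  measurableSet_Ioc

theorem next_mem (π : Partition t) {u : ℝ≥0} (hu : u ≤ t) :
    π.next u ∈ π.points ∧ u ≤ π.next u :=
  Set.Nonempty.csInf_mem (s := {x | x ∈ π.points ∧ u ≤ x}) ⟨t, π.end_mem, hu⟩
    (π.points.finite_toSet.subset fun _ hx => hx.1)

theorem next_le (π : Partition t) {u x : ℝ≥0} (hx : x ∈ π.points) (hu : u ≤ x) :
    π.next u ≤ x := csInf_le (OrderBot.bddBelow _) ⟨hx, hu⟩

/-- Positivity of `u` covers the case of no smaller partition point, where the supremum takes its
default value `0`. -/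
theorem pred_lt_iff (π : Partition t) {u x : ℝ≥0} (hu : 0 < u) :
    π.pred x < u ↔ ∀ y ∈ π.points, y < x → y < u := by
  rw [pred, Finset.sup_lt_iff hu]
  simp

theorem pred_le (π : Partition t) (x : ℝ≥0) : π.pred x ≤ x :=
  Finset.sup_le fun _ hy => (Finset.mem_filter.1 hy).2.le

/-- The cells are the fibres of `next` on `(0, t]`. Disjointness, covering and behaviour under
refinement are all read off from this. -/
theorem coe_mem_cell_iff (π : Partition t) {u x : ℝ≥0} (hx : x ∈ π.points) (hu : 0 < u)
    (hut : u ≤ t) : (u : ℝ≥0∞) ∈ π.cell x ↔ π.next u = x := by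
  rw [cell, Set.mem_Ioc, ENNReal.coe_lt_coe, ENNReal.coe_le_coe, pred_lt_iff π hu]
  obtain ⟨h1, h2⟩ := π.next_mem hut
  constructor
  · rintro ⟨h3, h4⟩
    refine le_antisymm (π.next_le hx h4) (not_lt.1 fun h5 => ?_)
    exact absurd (h3 _ h1 h5) (not_lt.2 h2)
  · rintro rfl
    exact ⟨fun y hy hlt => not_le.1 fun h3 => absurd hlt (not_lt.2 (π.next_le hy h3)), h2⟩

theorem exists_of_mem_cell (π : Partition t) {x : ℝ≥0} (hx : x ∈ π.points) {v : ℝ≥0∞}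
    (hv : v ∈ π.cell x) : ∃ u : ℝ≥0, v = u ∧ 0 < u ∧ u ≤ t ∧ π.next u = x := by
  lift v to ℝ≥0 using ne_top_of_le_ne_top ENNReal.coe_ne_top hv.2
  have h0 : 0 < v := ENNReal.coe_pos.1 (lt_of_le_of_lt zero_le hv.1)
  have ht : v ≤ t := (ENNReal.coe_le_coe.1 hv.2).trans (π.le_end x hx)
  exact ⟨v, rfl, h0, ht, (π.coe_mem_cell_iff hx h0 ht).1 hv⟩

theorem disjoint_cell (π : Partition t) {x y : ℝ≥0} (hx : x ∈ π.points) (hy : y ∈ π.points)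
    (hxy : x ≠ y) : Disjoint (π.cell x) (π.cell y) := by
  refine Set.disjoint_left.2 fun v h1 h2 => hxy ?_
  obtain ⟨u, rfl, hu, hut, rfl⟩ := π.exists_of_mem_cell hx h1
  exact (π.coe_mem_cell_iff hy hu hut).1 h2

theorem iUnion_cell (π : Partition t) :
    ⋃ y ∈ π.points.erase 0, π.cell y = Set.Ioc 0 (t : ℝ≥0∞) := by
  ext v
  simp only [Set.mem_iUnion, exists_prop]
  constructor
  · rintro ⟨y, hy, hv⟩
    obtain ⟨u, rfl, hu, hut, -⟩ := π.exists_of_mem_cell (Finset.mem_of_mem_erase hy) hv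
    exact ⟨ENNReal.coe_pos.2 hu, ENNReal.coe_le_coe.2 hut⟩
  · rintro ⟨h0, ht⟩
    lift v to ℝ≥0 using ne_top_of_le_ne_top ENNReal.coe_ne_top ht
    have h0 := ENNReal.coe_pos.1 h0
    have ht := ENNReal.coe_le_coe.1 ht
    obtain ⟨h1, h2⟩ := π.next_mem ht
    exact ⟨π.next v, Finset.mem_erase.2 ⟨(h0.trans_le h2).ne', h1⟩,
      (π.coe_mem_cell_iff h1 h0 ht).2 rfl⟩

theorem iUnion_cell_of_le {π π' : Partition t} (h : π ≤ π') {x : ℝ≥0} (hx : x ∈ π.points) :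
    ⋃ y ∈ (π'.points.erase 0).filter (π.next · = x), π'.cell y = π.cell x := by
  have hsub : π.points ⊆ π'.points := h
  -- Rounding up to the finer partition does not cross a point of the coarser one.
  have key : ∀ u ≤ t, π.next (π'.next u) = π.next u := by
    intro u hu
    obtain ⟨h1, h2⟩ := π.next_mem hu
    obtain ⟨h3, h4⟩ := π'.next_mem hu
    obtain ⟨h5, h6⟩ := π.next_mem (π'.le_end _ h3)
    exact le_antisymm (π.next_le h1 (π'.next_le (hsub h1) h2)) (π.next_le h5 (h4.trans h6))
  ext v
  simp only [Set.mem_iUnion, exists_prop, Finset.mem_filter]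
  constructor
  · rintro ⟨y, ⟨hy, hyx⟩, hv⟩
    obtain ⟨u, rfl, hu, hut, rfl⟩ := π'.exists_of_mem_cell (Finset.mem_of_mem_erase hy) hv
    rw [π.coe_mem_cell_iff hx hu hut, ← hyx, key u hut]
  · intro hv
    obtain ⟨u, rfl, hu, hut, rfl⟩ := π.exists_of_mem_cell hx hv
    obtain ⟨h3, h4⟩ := π'.next_mem hut
    exact ⟨π'.next u, ⟨Finset.mem_erase.2 ⟨(hu.trans_le h4).ne', h3⟩, key u hut⟩,
      (π'.coe_mem_cell_iff h3 hu hut).2 rfl⟩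

theorem exists_fine (t : ℝ≥0) {δ : ℝ≥0} (hδ : 0 < δ) :
    ∃ π : Partition t, ∀ u ≤ t, π.next u < u + δ := by
  let N := ⌈t / δ⌉₊
  -- Multiples of `δ` truncated at `t`; the index `N` itself is included so that `t` is reached.
  let P : Finset ℝ≥0 := (Finset.range (N + 1)).image fun i : ℕ => min (i * δ) t
  have hP : ∀ u ≤ t, min ((⌈u / δ⌉₊ : ℝ≥0) * δ) t ∈ P := fun u hu =>
    Finset.mem_image.2 ⟨⌈u / δ⌉₊, Finset.mem_range.2 (Nat.lt_succ_of_le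
      (Nat.ceil_mono (by gcongr))), rfl⟩
  have hle : ∀ u : ℝ≥0, u ≤ ⌈u / δ⌉₊ * δ := fun u => by
    rw [← div_le_iff₀ hδ]
    exact Nat.le_ceil _
  let π : Partition t := ⟨P, by simpa using hP 0 zero_le, by
    have h1 := hP t le_rfl
    rwa [min_eq_right (hle t)] at h1, fun x hx => by
      obtain ⟨i, -, rfl⟩ := Finset.mem_image.1 hx
      exact min_le_right _ _⟩
  refine ⟨π, fun u hu => (π.next_le (hP u hu) (le_min (hle u) hu)).trans_lt
    ((min_le_left _ _).trans_lt ?_)⟩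
  have h1 : (⌈u / δ⌉₊ : ℝ≥0) < u / δ + 1 := Nat.ceil_lt_add_one zero_le
  calc (⌈u / δ⌉₊ : ℝ≥0) * δ < (u / δ + 1) * δ := by gcongr
    _ = u + δ := by rw [add_mul, one_mul, div_mul_cancel₀ _ hδ.ne']

/-- The partition of `[0, s]` obtained by intersecting a partition of `[0, t]` with `[0, s]`. -/
noncomputable def restrict (π : Partition t) (s : ℝ≥0) : Partition s where
  points := insert s (π.points.filter (· ≤ s))
  zero_mem := Finset.mem_insert_of_mem (Finset.mem_filter.2 ⟨π.zero_mem, zero_le⟩)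
  end_mem := Finset.mem_insert_self _ _
  le_end _ hx := (Finset.mem_insert.1 hx).elim (fun h => h.le) fun h => (Finset.mem_filter.1 h).2

theorem tendsto_restrict {s : ℝ≥0} (hst : s ≤ t) :
    Tendsto (fun π : Partition t => π.restrict s) atTop atTop := by
  refine tendsto_atTop.2 fun π₀ => ?_
  -- Beyond `π₀` with `t` adjoined, every partition of `[0, t]` restricts to a refinement of `π₀`.
  let π₁ : Partition t := ⟨insert t π₀.points, Finset.mem_insert_of_mem π₀.zero_mem,
    Finset.mem_insert_self _ _, fun x hx => (Finset.mem_insert.1 hx).elim (fun h => h.le)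
      fun h => (π₀.le_end x h).trans hst⟩
  filter_upwards [eventually_ge_atTop π₁] with π hπ x hx
  exact Finset.mem_insert_of_mem (Finset.mem_filter.2
    ⟨hπ (Finset.mem_insert_of_mem hx), π₀.le_end x hx⟩)

theorem eventually_mem {s : ℝ≥0} (hst : s ≤ t) : ∀ᶠ π : Partition t in atTop, s ∈ π.points := by
  let π₁ : Partition t := ⟨{0, s, t}, by simp, by simp, by simp [hst]⟩
  filter_upwards [eventually_ge_atTop π₁] with π hπ
  exact hπ (show s ∈ ({0, s, t} : Finset ℝ≥0) by simp)

theorem points_restrict (π : Partition t) {s : ℝ≥0} (hs : s ∈ π.points) :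
    (π.restrict s).points = π.points.filter (· ≤ s) :=
  Finset.insert_eq_of_mem (Finset.mem_filter.2 ⟨hs, le_rfl⟩)

theorem cell_restrict (π : Partition t) {s : ℝ≥0} (hs : s ∈ π.points) {x : ℝ≥0} (hx : x ≤ s) :
    (π.restrict s).cell x = π.cell x := by
  have : (π.restrict s).pred x = π.pred x := by
    rw [pred, pred, points_restrict π hs, Finset.filter_filter]
    congr 1
    exact Finset.filter_congr fun y _ => ⟨fun h => h.2, fun h => ⟨h.le.trans hx, h⟩⟩
  rw [cell, cell, this]

end Partition

/-- Riemann sums can be compared only along refinements, so the Cauchy property is tested against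
one fixed earlier index. -/
theorem cauchySeq_of_dist_lt {X α : Type*} [PseudoMetricSpace X] [Preorder α]
    [IsDirectedOrder α] [Nonempty α] {u : α → X}
    (h : ∀ ε > 0, ∃ a₀, ∀ a ≥ a₀, dist (u a) (u a₀) < ε) : CauchySeq u := by
  refine Metric.cauchy_iff.2 ⟨inferInstance, fun ε hε => ?_⟩
  obtain ⟨a₀, h0⟩ := h (ε / 2) (half_pos hε)
  refine ⟨u '' Set.Ici a₀, image_mem_map (Ici_mem_atTop a₀), ?_⟩
  rintro _ ⟨a, ha, rfl⟩ _ ⟨b, hb, rfl⟩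
  linarith [dist_triangle_right (u a) (u b) (u a₀), h0 a ha, h0 b hb]

/-- A net of contractions that is Cauchy on a total family converges pointwise. -/
theorem exists_tendsto_of_total [CompleteSpace H] {α ι : Type*} [Preorder α]
    [IsDirectedOrder α] [Nonempty α] (T : α → H →L[ℂ] H) (hT : ∀ a z, ‖T a z‖ ≤ ‖z‖) {e : ι → H}
    (he : Total e) (hc : ∀ i, CauchySeq fun a => T a (e i)) (z : H) :
    ∃ w, Tendsto (fun a => T a z) atTop (𝓝 w) := by
  let W : Submodule ℂ H :=
    { carrier := {z | ∃ w, Tendsto (fun a => T a z) atTop (𝓝 w)}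
      zero_mem' := ⟨0, by simp⟩
      add_mem' := by
        rintro a b ⟨w, hw⟩ ⟨w', hw'⟩
        exact ⟨w + w', by simpa using hw.add hw'⟩
      smul_mem' := by
        rintro c a ⟨w, hw⟩
        exact ⟨c • w, by simpa using hw.const_smul c⟩ }
  have hW : IsClosed (W : Set H) := by
    refine isClosed_of_closure_subset fun z hz => ?_
    refine cauchySeq_tendsto_of_complete (cauchySeq_of_dist_lt fun ε hε => ?_)
    obtain ⟨y, ⟨w, hw⟩, hyz⟩ := Metric.mem_closure_iff.1 hz (ε / 3) (by positivity)
    obtain ⟨a₀, h0⟩ := eventually_atTop.1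
      (hw (Metric.ball_mem_nhds w (show 0 < ε / 6 by positivity)))
    refine ⟨a₀, fun a ha => ?_⟩
    have h4 : dist (T a y) w < ε / 6 := h0 a ha
    have h5 : dist (T a₀ y) w < ε / 6 := h0 a₀ le_rfl
    have h2 : ∀ a, dist (T a z) (T a y) < ε / 3 := fun a => by
      rw [dist_eq_norm, ← map_sub]
      exact (hT a _).trans_lt (by rwa [← dist_eq_norm])
    have h3 := h2 a₀
    rw [dist_comm] at h3
    linarith [dist_triangle4 (T a z) (T a y) (T a₀ y) (T a₀ z), h2 a,
      dist_triangle_right (T a y) (T a₀ y) w]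
  have hz : z ∈ W := (he.eq_top hW fun i => cauchySeq_tendsto_of_complete (hc i)) ▸
    Submodule.mem_top
  exact hz

/-- A sum of two idempotents is idempotent only if they anticommute. Multiplying `PQ + QP = 0` by
`P` on either side shows that `P` and `Q` also commute, so `2PQ = 0`. -/
theorem comp_eq_zero_of_disjoint {E : Set ℝ≥0∞ → H →L[ℂ] H}
    (idem : ∀ A, MeasurableSet A → E A ∘L E A = E A)
    (union : ∀ A B, MeasurableSet A → MeasurableSet B → Disjoint A B → E (A ∪ B) = E A + E B)
    {A B : Set ℝ≥0∞} (hA : MeasurableSet A)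
    (hB : MeasurableSet B) (hd : Disjoint A B) (z : H) : E A (E B z) = 0 := by
  have h1 := idem _ (hA.union hB)
  rw [union A B hA hB hd] at h1
  have hP : ∀ z, E A (E A z) = E A z := fun z => congrArg (fun T : H →L[ℂ] H => T z) (idem A hA)
  have hQ : ∀ z, E B (E B z) = E B z := fun z => congrArg (fun T : H →L[ℂ] H => T z) (idem B hB)
  have h2 : ∀ z, E A (E B z) + E B (E A z) = 0 := fun z => by
    have h3 := congrArg (fun T : H →L[ℂ] H => T z) h1
    simp only [ContinuousLinearMap.comp_apply, add_apply, map_add, hP, hQ] at h3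
    have h4 : E A z + E B z + (E A (E B z) + E B (E A z)) = E A z + E B z := by
      refine Eq.trans ?_ h3
      abel
    simpa using h4
  have h4 := congrArg (E A) (h2 z)
  have h5 := h2 (E A z)
  have h6 := h2 z
  simp only [map_add, map_zero, hP] at h4 h5
  have h7 : E A (E B z) = E B (E A z) := by
    rw [eq_neg_of_add_eq_zero_left h4, ← eq_neg_of_add_eq_zero_right h5]
  rw [← h7, ← two_smul ℂ] at h6
  exact (smul_eq_zero.1 h6).resolve_left two_ne_zero

/-! ### Abstract convergence of Riemann sums with orthogonal terms. -/

/-- A contraction-valued process `V` and a projection-valued additive set function `E` such that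
the Riemann sums of `V` against `E` converge. -/
structure IsStoppable {ι : Type*} (V : ℝ≥0 → H →L[ℂ] H) (E : Set ℝ≥0∞ → H →L[ℂ] H) (e : ι → H) :
    Prop where
  contraction : ∀ t z, ‖V t z‖ ≤ ‖z‖
  idem : ∀ A, MeasurableSet A → E A ∘L E A = E A
  symm : ∀ A, MeasurableSet A → ∀ x y, ⟪E A x, y⟫_ℂ = ⟪x, E A y⟫_ℂ
  union : ∀ A B, MeasurableSet A → MeasurableSet B → Disjoint A B → E (A ∪ B) = E A + E B
  -- The times may lie beyond the right endpoints: on refinement, a small cell still carries `V` at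
  -- the coarser endpoint.
  orthogonal : ∀ s t a b a' b' : ℝ≥0, a ≤ b → a' ≤ b' → b ≤ s → b' ≤ t →
    Disjoint (Set.Ioc (a : ℝ≥0∞) b) (Set.Ioc (a' : ℝ≥0∞) b') →
    ∀ x y, ⟪V s (E (Set.Ioc (a : ℝ≥0∞) b) x), V t (E (Set.Ioc (a' : ℝ≥0∞) b') y)⟫_ℂ = 0
  total : Total e
  -- The bound is relative to the norm of the projected vector, so that its squares can be summed
  -- over cells whatever their number.
  small : ∀ i t, ∀ ε : ℝ, 0 < ε → ∃ δ : ℝ≥0, 0 < δ ∧ ∀ a s s' : ℝ≥0, a ≤ s → s ≤ s' → s' < s + δ →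
    s ≤ t → ‖V s' (E (Set.Ioc (a : ℝ≥0∞) s) (e i)) - V s (E (Set.Ioc (a : ℝ≥0∞) s) (e i))‖ ≤
      ε * ‖E (Set.Ioc (a : ℝ≥0∞) s) (e i)‖

/-- The Riemann sum of `V` against `E` over a partition. -/
noncomputable def rsum (V : ℝ≥0 → H →L[ℂ] H) (E : Set ℝ≥0∞ → H →L[ℂ] H) {t : ℝ≥0}
    (π : Partition t) : H →L[ℂ] H :=
  ∑ x ∈ π.points.erase 0, V x ∘L E (π.cell x)

namespace IsStoppable

variable {ι : Type*} {V : ℝ≥0 → H →L[ℂ] H} {E : Set ℝ≥0∞ → H →L[ℂ] H} {e : ι → H}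

theorem comp_of_disjoint (h : IsStoppable V E e) {A B : Set ℝ≥0∞} (hA : MeasurableSet A)
    (hB : MeasurableSet B) (hd : Disjoint A B) (z : H) : E A (E B z) = 0 :=
  comp_eq_zero_of_disjoint h.idem h.union hA hB hd z

theorem empty (h : IsStoppable V E e) : E ∅ = 0 := by
  have := h.union ∅ ∅ .empty .empty (by simp)
  simpa using this

theorem biUnion (h : IsStoppable V E e) (s : Finset ℝ≥0) (A : ℝ≥0 → Set ℝ≥0∞)
    (hA : ∀ x, MeasurableSet (A x)) (hd : ∀ x ∈ s, ∀ y ∈ s, x ≠ y → Disjoint (A x) (A y)) :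
    E (⋃ x ∈ s, A x) = ∑ x ∈ s, E (A x) := by
  classical
  induction s using Finset.induction_on with
  | empty => simp [h.empty]
  | insert a s ha ih =>
    rw [Finset.set_biUnion_insert, Finset.sum_insert ha, h.union _ _ (hA a)
      (Finset.measurableSet_biUnion _ fun x _ => hA x), ih fun x hx y hy =>
        hd x (Finset.mem_insert_of_mem hx) y (Finset.mem_insert_of_mem hy)]
    refine Set.disjoint_iUnion₂_right.2 fun x hx =>
      hd a (Finset.mem_insert_self _ _) x (Finset.mem_insert_of_mem hx) ?_
    rintro rfl
    exact ha hx

theorem norm_apply_le (h : IsStoppable V E e) {A : Set ℝ≥0∞} (hA : MeasurableSet A) (z : H) :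
    ‖E A z‖ ≤ ‖z‖ := by
  have h1 : ‖E A z‖ ^ 2 ≤ ‖E A z‖ * ‖z‖ := by
    have h2 : ⟪E A z, E A z⟫_ℂ = ⟪E A z, z⟫_ℂ := by
      rw [← h.symm A hA]
      exact congrArg (fun x => ⟪x, z⟫_ℂ) (congrArg (fun T : H →L[ℂ] H => T z) (h.idem A hA))
    have h3 := norm_inner_le_norm (𝕜 := ℂ) (E A z) z
    rwa [← h2, inner_self_eq_norm_sq_to_K, norm_pow, RCLike.norm_ofReal, abs_norm] at h3
  by_contra! h4
  nlinarith [norm_nonneg z]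

theorem inner_eq_zero (h : IsStoppable V E e) {A B : Set ℝ≥0∞} (hA : MeasurableSet A)
    (hB : MeasurableSet B) (hd : Disjoint A B) (x y : H) : ⟪E A x, E B y⟫_ℂ = 0 := by
  rw [h.symm A hA, h.comp_of_disjoint hA hB hd, inner_zero_right]

theorem norm_sq_union (h : IsStoppable V E e) {A B : Set ℝ≥0∞} (hA : MeasurableSet A)
    (hB : MeasurableSet B) (hd : Disjoint A B) (z : H) :
    ‖E (A ∪ B) z‖ ^ 2 = ‖E A z‖ ^ 2 + ‖E B z‖ ^ 2 := by
  rw [h.union A B hA hB hd, add_apply, pow_two, pow_two, pow_two]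
  exact norm_add_sq_eq_norm_sq_add_norm_sq_of_inner_eq_zero _ _ (h.inner_eq_zero hA hB hd z z)

theorem sum_norm_sq_cell (h : IsStoppable V E e) {t : ℝ≥0} (π : Partition t) (z : H) :
    ∑ x ∈ π.points.erase 0, ‖E (π.cell x) z‖ ^ 2 = ‖E (Set.Ioc 0 (t : ℝ≥0∞)) z‖ ^ 2 := by
  have hd : ∀ x ∈ π.points.erase 0, ∀ y ∈ π.points.erase 0, x ≠ y →
      Disjoint (π.cell x) (π.cell y) := fun x hx y hy =>
    π.disjoint_cell (Finset.mem_of_mem_erase hx) (Finset.mem_of_mem_erase hy)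
  rw [← π.iUnion_cell, h.biUnion _ _ π.measurableSet_cell hd, sum_apply,
    norm_sq_sum_of_orthogonal _ _ fun x hx y hy hxy => h.inner_eq_zero (π.measurableSet_cell x)
      (π.measurableSet_cell y) (hd x hx y hy hxy) z z]

/-- Pythagoras on both sides, with contractivity of `V` applied term by term. -/
theorem norm_rsum_le (h : IsStoppable V E e) {t : ℝ≥0} (π : Partition t) (z : H) :
    ‖rsum V E π z‖ ≤ ‖E (Set.Ioc 0 (t : ℝ≥0∞)) z‖ := by
  refine (pow_le_pow_iff_left₀ (norm_nonneg _) (norm_nonneg _) two_ne_zero).1 ?_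
  rw [← h.sum_norm_sq_cell π, rsum, sum_apply, norm_sq_sum_of_orthogonal]
  · refine Finset.sum_le_sum fun x _ => ?_
    gcongr
    exact h.contraction _ _
  · intro x hx y hy hxy
    exact h.orthogonal x y _ x _ y (π.pred_le x) (π.pred_le y) le_rfl le_rfl
      (π.disjoint_cell (Finset.mem_of_mem_erase hx) (Finset.mem_of_mem_erase hy) hxy) z z

/-- Each coarse cell is the disjoint union of the fine cells whose endpoints round up to its own.
This puts both sums over the same index set. -/
theorem rsum_eq_of_le (h : IsStoppable V E e) {t : ℝ≥0} {π π' : Partition t} (hle : π ≤ π') :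
    rsum V E π = ∑ y ∈ π'.points.erase 0, V (π.next y) ∘L E (π'.cell y) := by
  classical
  have hmaps : ∀ y ∈ π'.points.erase 0, π.next y ∈ π.points.erase 0 := fun y hy => by
    obtain ⟨hy0, hy⟩ := Finset.mem_erase.1 hy
    obtain ⟨h1, h2⟩ := π.next_mem (π'.le_end y hy)
    exact Finset.mem_erase.2 ⟨((pos_iff_ne_zero.2 hy0).trans_le h2).ne', h1⟩
  rw [← Finset.sum_fiberwise_of_maps_to hmaps, rsum]
  refine Finset.sum_congr rfl fun x hx => ?_
  rw [← Partition.iUnion_cell_of_le hle (Finset.mem_of_mem_erase hx),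
    h.biUnion _ _ π'.measurableSet_cell, ContinuousLinearMap.comp_finsetSum]
  · exact Finset.sum_congr rfl fun y hy => by rw [(Finset.mem_filter.1 hy).2]
  · intro y hy y' hy' hne
    exact π'.disjoint_cell (Finset.mem_of_mem_erase (Finset.mem_filter.1 hy).1)
      (Finset.mem_of_mem_erase (Finset.mem_filter.1 hy').1) hne

theorem norm_rsum_sub_le (h : IsStoppable V E e) {t : ℝ≥0} {π π' : Partition t} (hle : π ≤ π')
    {z : H} {ε : ℝ} (hε : 0 ≤ ε)
    (hs : ∀ y ∈ π'.points, ‖V (π.next y) (E (π'.cell y) z) - V y (E (π'.cell y) z)‖ ≤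
      ε * ‖E (π'.cell y) z‖) :
    ‖rsum V E π z - rsum V E π' z‖ ≤ ε * ‖z‖ := by
  refine le_trans ?_ (mul_le_mul_of_nonneg_left
    (h.norm_apply_le (measurableSet_Ioc (a := 0) (b := (t : ℝ≥0∞))) z) hε)
  refine (pow_le_pow_iff_left₀ (norm_nonneg _) (by positivity) two_ne_zero).1 ?_
  rw [mul_pow, ← h.sum_norm_sq_cell π', h.rsum_eq_of_le hle, rsum, sum_apply,
    sum_apply, ← Finset.sum_sub_distrib, norm_sq_sum_of_orthogonal,
    Finset.mul_sum]
  · refine Finset.sum_le_sum fun y hy => ?_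
    rw [← mul_pow]
    gcongr
    exact hs y (Finset.mem_of_mem_erase hy)
  · intro x hx y hy hxy
    have hx := Finset.mem_of_mem_erase hx
    have hy := Finset.mem_of_mem_erase hy
    -- Each increment is a difference at the times `π.next y` and `y`; all four cross terms of an
    -- inner product vanish.
    have key : ∀ s t : ℝ≥0, x ≤ s → y ≤ t →
        ⟪V s (E (π'.cell x) z), V t (E (π'.cell y) z)⟫_ℂ = 0 := fun s t hs ht =>
      h.orthogonal s t _ x _ y (π'.pred_le x) (π'.pred_le y) hs ht (π'.disjoint_cell hx hy hxy) z z
    have nx := (π.next_mem (π'.le_end x hx)).2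
    have ny := (π.next_mem (π'.le_end y hy)).2
    simp only [ContinuousLinearMap.comp_apply, inner_sub_left, inner_sub_right]
    rw [key _ _ nx ny, key _ _ nx le_rfl, key _ _ le_rfl ny, key _ _ le_rfl le_rfl]
    simp

/-- Since `s` is a partition point, no cell straddles it: each cell lies inside `[0, s]` or is
disjoint from it. -/
theorem rsum_comp (h : IsStoppable V E e) {s t : ℝ≥0} {π : Partition t} (hs : s ∈ π.points) :
    rsum V E π ∘L E (Set.Icc 0 (s : ℝ≥0∞)) = rsum V E (π.restrict s) := by
  have hm : MeasurableSet (Set.Icc 0 (s : ℝ≥0∞)) := measurableSet_Icc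
  have h1 : ∀ x ∈ π.points.erase 0, E (π.cell x) ∘L E (Set.Icc 0 (s : ℝ≥0∞)) =
      if x ≤ s then E (π.cell x) else 0 := by
    intro x hx
    split_ifs with hxs
    · have hsub : π.cell x ⊆ Set.Icc 0 (s : ℝ≥0∞) := fun v hv =>
        ⟨zero_le, hv.2.trans (ENNReal.coe_le_coe.2 hxs)⟩
      rw [← Set.union_sdiff_cancel hsub, h.union _ _ (π.measurableSet_cell x)
        (hm.diff (π.measurableSet_cell x)) Set.disjoint_sdiff_right, ContinuousLinearMap.comp_add,
        h.idem _ (π.measurableSet_cell x)]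
      ext z
      simp [h.comp_of_disjoint (π.measurableSet_cell x) (hm.diff (π.measurableSet_cell x))
        Set.disjoint_sdiff_right z]
    · ext z
      refine h.comp_of_disjoint (π.measurableSet_cell x) hm (Set.disjoint_left.2 fun v hv hv' => ?_) z
      have h2 : s ≤ π.pred x :=
        Finset.le_sup (f := id) (Finset.mem_filter.2 ⟨hs, not_le.1 hxs⟩)
      exact absurd hv.1 (not_lt.2 (hv'.2.trans (ENNReal.coe_le_coe.2 h2)))
  rw [rsum, rsum, ContinuousLinearMap.finsetSum_comp, π.points_restrict hs, ← Finset.filter_erase,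
    Finset.sum_filter]
  refine Finset.sum_congr rfl fun x hx => ?_
  rw [ContinuousLinearMap.comp_assoc, h1 x hx]
  split_ifs with hxs
  · rw [π.cell_restrict hs hxs]
  · simp

theorem exists_tendsto_rsum [CompleteSpace H] (h : IsStoppable V E e) (t : ℝ≥0) (z : H) :
    ∃ w, Tendsto (fun π : Partition t => rsum V E π z) atTop (𝓝 w) := by
  refine exists_tendsto_of_total (fun π : Partition t => rsum V E π) (fun π z =>
    (h.norm_rsum_le π z).trans (h.norm_apply_le measurableSet_Ioc z)) h.total (fun i => ?_) z
  refine cauchySeq_of_dist_lt fun ε hε => ?_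
  -- The added `1` covers a zero vector and makes the final inequality strict.
  have hη : 0 < ε / (‖e i‖ + 1) := by positivity
  obtain ⟨δ, hδ, hsm⟩ := h.small i t _ hη
  obtain ⟨π₀, h0⟩ := Partition.exists_fine t hδ
  refine ⟨π₀, fun π hπ => ?_⟩
  rw [dist_comm, dist_eq_norm]
  refine (h.norm_rsum_sub_le hπ hη.le fun y hy => ?_).trans_lt ?_
  · have hyt := π.le_end y hy
    exact hsm _ y _ (π.pred_le y) (π₀.next_mem hyt).2 (h0 y hyt) hyt
  · rw [div_mul_eq_mul_div, div_lt_iff₀ (by positivity)]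
    exact mul_lt_mul_of_pos_left (lt_add_one _) hε

end IsStoppable

/-- A bounded net of operators that converges pointwise converges to a bounded operator. -/
theorem exists_clm_of_tendsto {α : Type*} {l : Filter α} [l.NeBot] (T : α → H →L[ℂ] H) {C : ℝ}
    (hC : ∀ a z, ‖T a z‖ ≤ C * ‖z‖) (hT : ∀ z, ∃ w, Tendsto (fun a => T a z) l (𝓝 w)) :
    ∃ T' : H →L[ℂ] H, ∀ z, Tendsto (fun a => T a z) l (𝓝 (T' z)) := by
  choose g hg using hT
  refine ⟨LinearMap.mkContinuous ⟨⟨g, fun x y => ?_⟩, fun c x => ?_⟩ C fun x => ?_, hg⟩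
  · exact tendsto_nhds_unique (hg (x + y)) (by simpa using (hg x).add (hg y))
  · exact tendsto_nhds_unique (hg (c • x)) (by simpa using (hg x).const_smul c)
  · exact le_of_tendsto (hg x).norm (Eventually.of_forall fun a => hC a x)

theorem IsStoppable.exists_limit [CompleteSpace H] {ι : Type*} {V : ℝ≥0 → H →L[ℂ] H}
    {E : Set ℝ≥0∞ → H →L[ℂ] H} {e : ι → H} (h : IsStoppable V E e) :
    ∃ VS : ℝ≥0 → H →L[ℂ] H,
      (∀ t : ℝ≥0, (∀ z, Tendsto (fun π : Partition t => rsum V E π z) atTop (𝓝 (VS t z))) ∧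
        VS t = VS t ∘L E (Set.Icc 0 (t : ℝ≥0∞)) ∧
        ∀ z, ‖VS t z‖ ≤ ‖E (Set.Icc 0 (t : ℝ≥0∞)) z‖) ∧
      ∃ VSinf : H →L[ℂ] H, ∀ z, Tendsto (fun t : ℝ≥0 => VS t z) atTop (𝓝 (VSinf z)) := by
  have hm : ∀ t : ℝ≥0, MeasurableSet (Set.Icc 0 (t : ℝ≥0∞)) := fun t => measurableSet_Icc
  have hcl : ∀ t : ℝ≥0, ∃ T : H →L[ℂ] H, ∀ z,
      Tendsto (fun π : Partition t => rsum V E π z) atTop (𝓝 (T z)) := fun t =>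
    exists_clm_of_tendsto (fun π => rsum V E π) (C := 1)
      (fun π z => by
        rw [one_mul]; exact (h.norm_rsum_le π z).trans (h.norm_apply_le measurableSet_Ioc z))
      (h.exists_tendsto_rsum t)
  choose VS hVS using hcl
  have hcomp : ∀ s t : ℝ≥0, s ≤ t → ∀ z, VS t (E (Set.Icc 0 (s : ℝ≥0∞)) z) = VS s z := by
    intro s t hst z
    refine tendsto_nhds_unique ((hVS t _).congr' ?_)
      ((hVS s z).comp (Partition.tendsto_restrict hst))
    filter_upwards [Partition.eventually_mem hst] with π hπ
    exact congrArg (fun T : H →L[ℂ] H => T z) (h.rsum_comp hπ)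
  have hn : ∀ (t : ℝ≥0) z, ‖VS t z‖ ≤ ‖z‖ := fun t z =>
    le_of_tendsto (hVS t z).norm (Eventually.of_forall fun π =>
      (h.norm_rsum_le π z).trans (h.norm_apply_le measurableSet_Ioc z))
  -- By `hcomp` the difference is the contraction `VS t` applied to `E([0,t] \ [0,s]) z`, whose
  -- squared norm is the right-hand side.
  have hsq : ∀ s t : ℝ≥0, s ≤ t → ∀ z, ‖VS t z - VS s z‖ ^ 2 ≤
      ‖E (Set.Icc 0 (t : ℝ≥0∞)) z‖ ^ 2 - ‖E (Set.Icc 0 (s : ℝ≥0∞)) z‖ ^ 2 := by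
    intro s t hst z
    have hsub : Set.Icc 0 (s : ℝ≥0∞) ⊆ Set.Icc 0 (t : ℝ≥0∞) :=
      Set.Icc_subset_Icc_right (ENNReal.coe_le_coe.2 hst)
    have h1 := h.norm_sq_union (hm s) ((hm t).diff (hm s)) Set.disjoint_sdiff_right z
    have h2 := h.union _ _ (hm s) ((hm t).diff (hm s)) Set.disjoint_sdiff_right
    rw [Set.union_sdiff_cancel hsub] at h1 h2
    have h3 : VS t z - VS s z =
        VS t (E (Set.Icc 0 (t : ℝ≥0∞) \ Set.Icc 0 (s : ℝ≥0∞)) z) := by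
      rw [← hcomp t t le_rfl z, ← hcomp s t hst z, h2, add_apply, map_add, add_sub_cancel_left]
    rw [h1, add_sub_cancel_left, h3]
    gcongr
    exact hn _ _
  refine ⟨VS, fun t => ⟨hVS t, ?_, fun z => ?_⟩, ?_⟩
  · ext z
    exact (hcomp t t le_rfl z).symm
  · rw [← hcomp t t le_rfl z]
    exact hn _ _
  · refine exists_clm_of_tendsto VS (C := 1) (fun t z => by rw [one_mul]; exact hn t z) fun z => ?_
    -- A bounded monotone function is Cauchy at infinity, and `hsq` transfers this to `VS t z`.
    have hmono : Monotone fun t : ℝ≥0 => ‖E (Set.Icc 0 (t : ℝ≥0∞)) z‖ ^ 2 := fun s t hst => by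
      have := (sq_nonneg _).trans (hsq s t hst z)
      exact sub_nonneg.1 this
    have hbdd : BddAbove (Set.range fun t : ℝ≥0 => ‖E (Set.Icc 0 (t : ℝ≥0∞)) z‖ ^ 2) := by
      refine ⟨‖z‖ ^ 2, ?_⟩
      rintro _ ⟨t, rfl⟩
      exact pow_le_pow_left₀ (norm_nonneg _) (h.norm_apply_le (hm t) z) 2
    have hcs := (tendsto_atTop_ciSup hmono hbdd).cauchySeq
    refine cauchySeq_tendsto_of_complete (Metric.cauchySeq_iff'.2 fun ε hε => ?_)
    obtain ⟨s, hs⟩ := Metric.cauchySeq_iff'.1 hcs (ε ^ 2) (by positivity)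
    refine ⟨s, fun t ht => ?_⟩
    rw [dist_eq_norm]
    refine (pow_lt_pow_iff_left₀ (norm_nonneg _) hε.le two_ne_zero).1
      ((hsq s t ht z).trans_lt ((le_abs_self _).trans_lt ?_))
    exact hs t ht

end Convergence

/-! ### Continuity of the left shift and of the exponential map. -/

section Shift

variable {k : Type u} [NormedAddCommGroup k] [InnerProductSpace ℂ k] [CompleteSpace k]

/-- Extend `f` by zero to the real line, where translation is continuous in `L²`, and restrict to
the half-line again. -/
theorem continuous_leftShift (f : L2 k half) : Continuous fun t : ℝ≥0 => leftShift t f := by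
  have hF : MemLp (half.indicator f) 2 (volume : Measure ℝ) :=
    (memLp_indicator_iff_restrict measurableSet_Ici).2 (Lp.memLp f)
  have hmp : ∀ t : ℝ≥0, MeasurePreserving (fun s : ℝ => s + t) volume volume := fun t =>
    measurePreserving_add_right volume (t : ℝ)
  let c : ℝ≥0 → C(ℝ, ℝ) := fun t => ⟨fun s => s + t, by fun_prop⟩
  have hc : Continuous c := ContinuousMap.continuous_of_continuous_uncurry _ (by
    change Continuous fun p : ℝ≥0 × ℝ => p.2 + (p.1 : ℝ)
    fun_prop)
  have hG := Continuous.compMeasurePreservingLp (μ := volume) (ν := volume) (p := 2)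
    (continuous_const (y := hF.toLp)) hc hmp (by simp)
  have key : (fun t : ℝ≥0 => leftShift t f) = fun t : ℝ≥0 =>
      LpToLpRestrictCLM ℝ k ℂ volume 2 half
        (Lp.compMeasurePreserving (c t) (hmp t) hF.toLp) := by
    funext t
    rw [leftShift, LinearIsometryEquiv.symm_apply_eq]
    refine Lp.ext ((coeFn_res _ _).trans (EventuallyEq.symm ?_))
    refine (coeFn_shift t _).trans ?_
    have h1 := (measurePreserving_shift t).quasiMeasurePreserving.ae_eq_comp
      (LpToLpRestrictCLM_coeFn ℂ half (Lp.compMeasurePreserving (c t) (hmp t) hF.toLp))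
    have h2 := (measurePreserving_shift t).quasiMeasurePreserving.ae_eq_comp
      (ae_restrict_of_ae (s := half) (Lp.coeFn_compMeasurePreserving hF.toLp (hmp t)))
    have h3 : (hF.toLp : ℝ → k) =ᵐ[volume.restrict (future t)] half.indicator f :=
      ae_restrict_of_ae hF.coeFn_toLp
    filter_upwards [h1, h2, h3, ae_restrict_mem measurableSet_Ici] with s e1 e2 e3 hs
    simp only [Function.comp_apply, sub_add_cancel] at e1 e2
    refine e1.trans (e2.trans (e3.trans ?_))
    exact Set.indicator_of_mem (future_subset t hs) _
  rw [key]
  exact (LpToLpRestrictCLM ℝ k ℂ volume 2 half).continuous.comp hG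

/-- The distance between two exponential vectors is an explicit continuous function of their Gram
matrix. -/
theorem continuous_expVec {h : Type*} [NormedAddCommGroup h] [InnerProductSpace ℂ h] :
    Continuous (expVec : h → Fock h) := by
  refine continuous_iff_continuousAt.2 fun f => ?_
  rw [ContinuousAt, tendsto_iff_norm_sub_tendsto_zero]
  have h1 : ∀ g : h, ‖expVec g - expVec f‖ = Real.sqrt (RCLike.re
      (Complex.exp ⟪g, g⟫_ℂ - Complex.exp ⟪f, g⟫_ℂ -
        (Complex.exp ⟪g, f⟫_ℂ - Complex.exp ⟪f, f⟫_ℂ))) := fun g => by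
    rw [@norm_eq_sqrt_re_inner ℂ]
    simp only [inner_sub_left, inner_sub_right, inner_expVec]
  simp only [h1]
  have h2 : Continuous fun g : h => Real.sqrt (RCLike.re
      (Complex.exp ⟪g, g⟫_ℂ - Complex.exp ⟪f, g⟫_ℂ -
        (Complex.exp ⟪g, f⟫_ℂ - Complex.exp ⟪f, f⟫_ℂ))) := by
    refine Real.continuous_sqrt.comp (RCLike.continuous_re.comp ?_)
    fun_prop
  simpa using h2.tendsto f

end Shift

/-! ### Adaptedness and additivity of quantum stop times. -/

section StopTime

variable {k : Type u} [NormedAddCommGroup k] [InnerProductSpace ℂ k] [CompleteSpace k]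
variable {ini : Type v} [NormedAddCommGroup ini] [InnerProductSpace ℂ ini] [CompleteSpace ini]

namespace QuantumStopTime

variable (S : QuantumStopTime k)

theorem proj_union {A B : Set ℝ≥0∞} (hA : MeasurableSet A) (hB : MeasurableSet B)
    (hd : Disjoint A B) : S.proj (A ∪ B) = S.proj A + S.proj B := by
  ext y
  refine ext_inner_left ℂ fun x => ?_
  obtain ⟨μ, hμ⟩ := S.isMeasure x y
  rw [add_apply, inner_add_right, ← hμ _ hA, ← hμ _ hB, ← hμ _ (hA.union hB),
    VectorMeasure.of_union hd hA hB]

/-- The structure gives adaptedness for `t > 0` only; at `t = 0` the operator is `S({0})`, a scalar.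
-/
theorem isAdaptedAt_Icc (t : ℝ≥0) : IsAdaptedAt t (S.proj (Set.Icc 0 (t : ℝ≥0∞))) := by
  rcases eq_zero_or_pos t with rfl | ht
  · obtain ⟨c, hc⟩ := S.proj_zero
    rw [ENNReal.coe_zero, Set.Icc_self, hc]
    exact isAdaptedAt_smul_one _ _
  · exact S.adapted t ht

/-- This holds because `S((a,b]) = S([0,b]) - S([0,a])`, and both terms stay adapted at later times.
-/
theorem isAdaptedAt_Ioc {a b t : ℝ≥0} (hab : a ≤ b) (hbt : b ≤ t) :
    IsAdaptedAt t (S.proj (Set.Ioc (a : ℝ≥0∞) b)) := by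
  have h1 : Set.Icc (0 : ℝ≥0∞) b = Set.Icc 0 (a : ℝ≥0∞) ∪ Set.Ioc (a : ℝ≥0∞) b :=
    (Set.Icc_union_Ioc_eq_Icc zero_le (ENNReal.coe_le_coe.2 hab)).symm
  have h2 := S.proj_union (A := Set.Icc 0 (a : ℝ≥0∞)) (B := Set.Ioc (a : ℝ≥0∞) b)
    measurableSet_Icc measurableSet_Ioc
    (Set.disjoint_left.2 fun x hx hx' => not_lt.2 hx.2 hx'.1)
  rw [← h1] at h2
  rw [← sub_eq_of_eq_add' h2]
  exact ((S.isAdaptedAt_Icc b).mono hbt).sub ((S.isAdaptedAt_Icc a).mono (hab.trans hbt))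

variable (ini)

theorem amp_idem (A : Set ℝ≥0∞) (hA : MeasurableSet A) :
    S.amp ini A ∘L S.amp ini A = S.amp ini A :=
  (isStarProjection_tmap_one (S.isStarProjection A hA)).isIdempotentElem

theorem amp_symm (A : Set ℝ≥0∞) (hA : MeasurableSet A) (x y : HTensor ini (FockOn k half)) :
    ⟪S.amp ini A x, y⟫_ℂ = ⟪x, S.amp ini A y⟫_ℂ := by
  have h1 : ContinuousLinearMap.adjoint (S.amp ini A) = S.amp ini A :=
    (isStarProjection_tmap_one (S.isStarProjection A hA)).isSelfAdjoint
  rw [← ContinuousLinearMap.adjoint_inner_left, h1]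

theorem amp_union (A B : Set ℝ≥0∞) (hA : MeasurableSet A) (hB : MeasurableSet B)
    (hd : Disjoint A B) : S.amp ini (A ∪ B) = S.amp ini A + S.amp ini B := by
  rw [amp, amp, amp, S.proj_union hA hB hd, tmap_add_right]

end QuantumStopTime

/-! ### Stopping an isometric cocycle. -/

namespace AdaptedProcess

variable {𝒜 : VonNeumannAlgebra ini} {p : k →L[ℂ] k} {V : AdaptedProcess k 𝒜 p}

theorem IsIsometric.norm_hat (h : V.IsIsometric) (t : ℝ≥0) (z : HTensor ini (FockOn k half)) :
    ‖V.hat t z‖ = ‖z‖ := by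
  rw [hat, norm_pull_apply, norm_tmap_one_right (h t), LinearIsometryEquiv.norm_map]

theorem IsIsometric.inner_hat (h : V.IsIsometric) (t : ℝ≥0) (x y : HTensor ini (FockOn k half)) :
    ⟪V.hat t x, V.hat t y⟫_ℂ = ⟪x, y⟫_ℂ :=
  LinearIsometry.inner_map_map (E := HTensor ini (FockOn k half))
    (E' := HTensor ini (FockOn k half)) ⟨(V.hat t).toLinearMap, h.norm_hat t⟩ x y

theorem IsIsometric.norm_op_apply_le (h : V.IsIsometric) (t : ℝ≥0)
    (z : HTensor ini (FockOn k half)) : ‖V.op t z‖ ≤ ‖z‖ := by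
  have h1 : ‖V.pre t‖ ≤ 1 := ContinuousLinearMap.opNorm_le_bound _ zero_le_one fun x => by
    rw [one_mul, (ContinuousLinearMap.norm_map_iff_adjoint_comp_self _).2 (h t) x]
  have h2 : ‖quantProj p (future t)‖ ≤ 1 := Submodule.starProjection_norm_le _
  rw [V.op_eq, ← one_mul ‖z‖]
  exact ContinuousLinearMap.le_of_opNorm_le _ ((norm_pull_le _ _).trans
    ((norm_tmap_le _ _).trans (mul_le_one₀ h1 (norm_nonneg _) h2))) z

theorem IsCocycle.op_apply (h : V.IsCocycle) {s t : ℝ≥0} (hst : s ≤ t)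
    (z : HTensor ini (FockOn k half)) :
    V.op t z = V.hat s (ccrFlow s (V.op (t - s)) z) := by
  conv_lhs => rw [← add_tsub_cancel_of_le hst, h s (t - s)]
  rfl

/-- Both vectors are brought under the same isometry `V̂_s`, which drops out; the projection for
`(a,b]` then passes through both flows and annihilates the other one. -/
theorem inner_op_amp_eq_zero (S : QuantumStopTime k) (hcoc : V.IsCocycle) (hiso : V.IsIsometric)
    {s t a b : ℝ≥0} (hst : s ≤ t) (hab : a ≤ b) (hbs : b ≤ s) {B : Set ℝ≥0∞}
    (hB : MeasurableSet B) (hd : Disjoint (Set.Ioc (a : ℝ≥0∞) b) B)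
    (x y : HTensor ini (FockOn k half)) :
    ⟪V.op s (S.amp ini (Set.Ioc (a : ℝ≥0∞) b) x), V.op t (S.amp ini B y)⟫_ℂ = 0 := by
  have hcomm : ∀ (Y : HTensor ini (FockOn k half) →L[ℂ] HTensor ini (FockOn k half)) z,
      S.amp ini (Set.Ioc (a : ℝ≥0∞) b) (ccrFlow s Y z) =
        ccrFlow s Y (S.amp ini (Set.Ioc (a : ℝ≥0∞) b) z) := fun Y z =>
    congrArg (fun T : HTensor ini (FockOn k half) →L[ℂ] HTensor ini (FockOn k half) => T z)
      ((S.isAdaptedAt_Ioc hab hbs).comp_ccrFlow Y)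
  rw [hcoc.op_apply le_rfl, hcoc.op_apply hst, hiso.inner_hat, ← hcomm,
    S.amp_symm ini _ measurableSet_Ioc, hcomm,
    comp_eq_zero_of_disjoint (S.amp_idem ini) (S.amp_union ini) measurableSet_Ioc hB hd,
    map_zero, inner_zero_right]

theorem exists_small (hiso : V.IsIsometric)
    (hcont : V.IsStronglyContinuous) (u : ini) (f : L2 k half) (t : ℝ≥0) {ε : ℝ} (hε : 0 < ε) :
    ∃ δ : ℝ≥0, 0 < δ ∧ ∀ r s : ℝ≥0, r < δ → s ≤ t →
      ‖V.op r (tmul u (expVec (leftShift s f))) - V.op 0 (tmul u (expVec (leftShift s f)))‖ <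
        ε := by
  -- Strong continuity becomes joint continuity because all `V_r` are contractions.
  have h1 : Continuous fun q : ℝ≥0 × HTensor ini (FockOn k half) => V.op q.1 q.2 := by
    refine continuous_prod_of_continuous_lipschitzWith' _ 1 (fun r => ?_) fun z => hcont z
    exact LipschitzWith.of_dist_le_mul fun z w => by
      rw [dist_eq_norm, dist_eq_norm, NNReal.coe_one, one_mul]
      exact (congrArg norm (map_sub (V.op r) z w)).symm.trans_le (hiso.norm_op_apply_le r _)
  have h2 : Continuous fun s : ℝ≥0 => tmul u (expVec (leftShift s f)) :=
    continuous_tmul.comp (continuous_const.prodMk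
      (continuous_expVec.comp (continuous_leftShift f)))
  have h3 : Continuous fun q : ℝ≥0 × ℝ≥0 => ‖V.op q.1 (tmul u (expVec (leftShift q.2 f))) -
      V.op 0 (tmul u (expVec (leftShift q.2 f)))‖ :=
    ((h1.comp (continuous_fst.prodMk (h2.comp continuous_snd))).sub
      ((V.op 0).continuous.comp (h2.comp continuous_snd))).norm
  -- The difference vanishes on `{0} × [0, t]`, so compactness of `[0, t]` gives one `δ` for all `s
  -- ≤ t`.
  obtain ⟨A, B, hA, -, h0A, hB, hAB⟩ := generalized_tube_lemma (isCompact_singleton (x := (0 : ℝ≥0)))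
    (isCompact_Icc (a := (0 : ℝ≥0)) (b := t)) (isOpen_lt h3 continuous_const) (by
      rintro ⟨r, s⟩ ⟨hr, -⟩
      rw [Set.mem_singleton_iff] at hr
      subst hr
      simpa using hε)
  obtain ⟨δ, hδ, hball⟩ := Metric.mem_nhds_iff.1 (hA.mem_nhds (h0A rfl))
  refine ⟨⟨δ, hδ.le⟩, hδ, fun r s hr hs => ?_⟩
  refine hAB (Set.mk_mem_prod (hball ?_) (hB ⟨zero_le, hs⟩) : (r, s) ∈ A ×ˢ B)
  rw [Metric.mem_ball, NNReal.dist_eq, NNReal.coe_zero, sub_zero, abs_of_nonneg r.coe_nonneg]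
  exact hr

theorem isStoppable (S : QuantumStopTime k) (hcoc : V.IsCocycle) (hiso : V.IsIsometric)
    (hcont : V.IsStronglyContinuous) :
    IsStoppable V.op (S.amp ini) fun z : ini × L2 k half => tmul z.1 (expVec z.2) where
  contraction := hiso.norm_op_apply_le
  idem := S.amp_idem ini
  symm := S.amp_symm ini
  union := S.amp_union ini
  orthogonal := by
    intro s t a b a' b' hab hab' hbs hbt hd x y
    rcases le_total s t with hst | hst
    · exact inner_op_amp_eq_zero S hcoc hiso hst hab hbs measurableSet_Ioc hd x y
    · rw [inner_eq_zero_symm]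
      exact inner_op_amp_eq_zero S hcoc hiso hst hab' hbt measurableSet_Ioc hd.symm y x
  total := total_tmul_expVec
  small := by
    rintro ⟨u, f⟩ t ε hε
    rcases eq_or_ne u 0 with rfl | hu
    · refine ⟨1, one_pos, fun a s s' _ _ _ _ => ?_⟩
      have h0 : tmul (0 : ini) (expVec f) = 0 := by
        rw [← zero_smul ℂ (0 : ini), smul_tmul, zero_smul]
      simp [h0]
    · have hu := norm_pos_iff.2 hu
      -- The tolerance `ε ‖u‖` offsets the factor `‖u‖` in `norm_ccrFlow_sub_le`; this is why `u =
      -- 0` is treated separately.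
      obtain ⟨δ, hδ, h⟩ := exists_small hiso hcont u f t (mul_pos hε hu)
      refine ⟨δ, hδ, fun a s s' has hss' hs' hst => ?_⟩
      have h1 := norm_ccrFlow_sub_le (S.isAdaptedAt_Ioc has le_rfl) (V.op (s' - s)) (V.op 0) u f
      have h2 := h (s' - s) s (by rwa [tsub_lt_iff_left hss']) hst
      -- The cocycle identity is also applied to `V_s` itself: `V_0` need not be the identity, so
      -- the comparison is between `σ_s(V_{s'-s})` and `σ_s(V_0)`.
      rw [hcoc.op_apply hss', hcoc.op_apply (le_refl s), tsub_self, ← map_sub, hiso.norm_hat]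
      refine le_of_mul_le_mul_right (h1.trans ?_) hu
      refine (mul_le_mul_of_nonneg_left h2.le (norm_nonneg _)).trans_eq ?_
      rw [QuantumStopTime.amp]
      ring

end AdaptedProcess

end StopTime

end QStop

theorem mainTheorem4
    {k : Type*} [NormedAddCommGroup k] [InnerProductSpace ℂ k] [CompleteSpace k]
    {ini : Type*} [NormedAddCommGroup ini] [InnerProductSpace ℂ ini] [CompleteSpace ini]
    (𝒜 : VonNeumannAlgebra ini) (p : k →L[ℂ] k) (hp : IsStarProjection p)
    (S : QStop.QuantumStopTime k) (hS : S.IsFinite)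
    (V : QStop.AdaptedProcess k 𝒜 p) (hcoc : V.IsCocycle) (hiso : V.IsIsometric)
    (hcont : V.IsStronglyContinuous) :
    ∃ VS : ℝ≥0 → (QStop.HTensor ini (QStop.FockOn k QStop.half) →L[ℂ]
        QStop.HTensor ini (QStop.FockOn k QStop.half)),
      (∀ t : ℝ≥0, 0 < t →
        (∀ z, Tendsto (fun π : QStop.Partition t => QStop.riemannSum V.op S π z) atTop
          (𝓝 (VS t z))) ∧
        VS t = VS t ∘L S.amp ini (Set.Icc 0 (t : ℝ≥0∞)) ∧
        ∀ z, ‖VS t z‖ ≤ ‖S.amp ini (Set.Icc 0 (t : ℝ≥0∞)) z‖) ∧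
      ∃ VSinf : QStop.HTensor ini (QStop.FockOn k QStop.half) →L[ℂ]
          QStop.HTensor ini (QStop.FockOn k QStop.half),
        ∀ z, Tendsto (fun t : ℝ≥0 => VS t z) atTop (𝓝 (VSinf z)) := by
  obtain ⟨VS, h, hinf⟩ := (QStop.AdaptedProcess.isStoppable S hcoc hiso hcont).exists_limit
  exact ⟨VS, fun t _ => h t, hinf⟩
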